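/- Let $(T(t))_{t\ge 0}$ be a $C_0$-semigroup with generator $(A,D(A))$ on a complex Banach space $X$ such that $\|T(t)\|\le Me^{-\omega t}$ for all $t>0$ and some $\omega>0$. Let $\mu\in\rho(A)$, let $X_{-1}$ be the extrapolation space, i.e. the completion of $X$ for the norm $\|x\|_{-1}=\|R(\mu,A)x\|$, and let $T_{-1}(t)$ be the continuous extension of $T(t)$ to $X_{-1}$; this is a $C_0$-semigroup with generator $A_{-1}$. Let $$F_0=\Bigl\{y\in X_{-1}:\ \|y\|_{F_0}:=\sup_{t>0}\bigl\|\tfrac1t\,(T_{-1}(t)y-y)\bigr\|_{-1}<\infty\Bigr\}$$ be the Favard class of $(T_{-1}(t))_{t\ge0}$; it is continuously embedded in $X_{-1}$. Consider constants $m>0$ such that for all $f\in L^1_{\mathrm{loc}}(\mathbb R_+,F_0)$ and $t>0$ $$\int_0^tT_{-1}(t-r)f(r)\,dr\in X,\qquad \Bigl\|\int_0^tT_{-1}(t-r)f(r)\,dr\Bigr\|_X\le m\int_0^te^{-\omega(t-r)}\|f(r)\|_{F_0}\,dr.\tag{$*$}$$ Such a constant $m>0$ exists. Moreover, if $m>0$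 is any constant satisfying $(*)$ and $B\in\mathcal L(X,F_0)$ satisfies $m\|B\|_{\mathcal L(X,F_0)}<\omega$, then $(B,\mathrm{Id})$, with $U=Z=X$ and $C=\mathrm{Id}$, is an infinite-time Staffans--Weiss perturbation of $A$. Here, for Banach spaces $U$ and $Z$ with continuous embeddings $X_1\hookrightarrow Z\hookrightarrow X$ (where $X_1$ is $D(A)$ with the graph norm), $B\in\mathcal L(U,X_{-1})$ and $C\in\mathcal L(Z,U)$, the pair $(B,C)$ is called an *infinite-time Staffans--Weiss perturbation* of $A$ if for some $1\le p<\infty$: 1. $\operatorname{range}(R(\lambda,A_{-1})B)\subset Z$ for some $\lambda\in\rho(A)$; 2. for some $t>0$, $\int_0^tT_{-1}(t-s)Bu(s)\,ds\in X$ for all $u\in L^p(0,t;U)$; 3. for some $t>0$ and $M_C\ge 0$, $\int_0^t\|CT(s)x\|_U^p\,ds\le M_C\|x\|^p$ for all $x\in D(A)$; 4. for some $t>0$ and $M_{BC}\ge 0$, $\int_0^t\bigl\|C\int_0^rT_{-1}(r-s)Bu(s)\,ds\bigr\|_U^p\,dr\le M_{BC}\|u\|_p^p$ for all $u\in W^{2,p}(0,t;U)$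 with $u(0)=u'(0)=0$; 5. $I-\mathcal F_t$ is invertible for some $t>0$, where $\mathcal F_t\in\mathcal L(L^p(0,t;U))$ is the bounded extension of $u\mapsto C\int_0^{\cdot}T_{-1}(\cdot-s)Bu(s)\,ds$ from the functions $u$ in 4; 6. there is $M_B\ge0$ such that for all $t>0$ and $u\in L^p(0,t;U)$ one has $\int_0^tT_{-1}(t-s)Bu(s)\,ds\in X$ and $\bigl\|\int_0^tT_{-1}(t-s)Bu(s)\,ds\bigr\|_X\le M_B\|u\|_{L^p(0,t;U)}$; 7. for all $t>0$ the operators $\mathcal F_t$, $\mathcal C_t$ and $(I-\mathcal F_t)^{-1}$ exist, and $\sup_{t>0}\|(I-\mathcal F_t)^{-1}\mathcal C_t\|_{\mathcal L(X,L^p(0,t;U))}<\infty$, where $\mathcal C_t\in\mathcal L(X,L^p(0,t;U))$ is the bounded extension of $D(A)\ni x\mapsto CT(\cdot)x$. -/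

import Mathlib

open MeasureTheory Filter Topology
open scoped NNReal ENNReal

noncomputable section

/-! ### Strongly continuous semigroups, generators, resolvents -/

/-- A `C₀`-semigroup `(T(t))_{t ≥ 0}` of bounded linear operators on a complex normed space. -/
structure C0Semigroup (X : Type*) [NormedAddCommGroup X] [NormedSpace ℂ X] where
  /-- the operator `T(t)` -/
  op : ℝ≥0 → X →L[ℂ] X
  op_zero : op 0 = ContinuousLinearMap.id ℂ X
  op_add : ∀ s t : ℝ≥0, op (s + t) = (op s).comp (op t)
  strongly_continuous : ∀ x : X, Continuous fun t : ℝ≥0 => op t x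

namespace C0Semigroup

section Basic

variable {X : Type*} [NormedAddCommGroup X] [NormedSpace ℂ X]

/-- The difference quotient `(1/t) (T(t)x - x)`. -/
def diffQuot (T : C0Semigroup X) (t : ℝ≥0) (x : X) : X := (t : ℝ)⁻¹ • (T.op t x - x)

theorem diffQuot_add (T : C0Semigroup X) (t : ℝ≥0) (x y : X) :
    T.diffQuot t (x + y) = T.diffQuot t x + T.diffQuot t y := by
  simp only [diffQuot, map_add, ← smul_add]
  congr 1
  abel

theorem diffQuot_smul (T : C0Semigroup X) (t : ℝ≥0) (c : ℂ) (x : X) :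
    T.diffQuot t (c • x) = c • T.diffQuot t x := by
  simp only [diffQuot, map_smul, ← smul_sub]
  rw [smul_comm]

/-- The generator `(A, D(A))`: `D(A)` is the set of all `x` for which
`Ax = lim_{t ↓ 0} (1/t) (T(t)x - x)` exists. -/
def generator (T : C0Semigroup X) : X →ₗ.[ℂ] X where
  domain :=
    { carrier := {x | ∃ y, Tendsto (fun t => T.diffQuot t x) (𝓝[>] 0) (𝓝 y)}
      add_mem' := by
        rintro a b ⟨y, hy⟩ ⟨z, hz⟩
        exact ⟨y + z, by simpa only [diffQuot_add] using hy.add hz⟩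
      zero_mem' := ⟨0, by simp [diffQuot]⟩
      smul_mem' := by
        rintro c a ⟨y, hy⟩
        exact ⟨c • y, by simpa only [diffQuot_smul] using hy.const_smul c⟩ }
  toFun :=
    { toFun := fun x => x.2.choose
      map_add' := fun x y => tendsto_nhds_unique (x + y).2.choose_spec (by
        simpa only [Submodule.coe_add, diffQuot_add] using
          x.2.choose_spec.add y.2.choose_spec)
      map_smul' := fun c x => tendsto_nhds_unique (c • x).2.choose_spec (by
        simpa only [Submodule.coe_smul, diffQuot_smul, RingHom.id_apply] using
          x.2.choose_spec.const_smul c) }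

theorem generator_spec (T : C0Semigroup X) (x : T.generator.domain) :
    Tendsto (fun t => T.diffQuot t (x : X)) (𝓝[>] 0) (𝓝 (T.generator x)) :=
  x.2.choose_spec

/-- `R` is a bounded two-sided inverse of `μ - A : D(A) → X`. -/
def IsResolventAt (T : C0Semigroup X) (μ : ℂ) (R : X →L[ℂ] X) : Prop :=
  (∀ x : X, ∃ h : R x ∈ T.generator.domain, μ • R x - T.generator ⟨R x, h⟩ = x) ∧
    ∀ x : T.generator.domain, R (μ • (x : X) - T.generator x) = x

/-- The resolvent set `ρ(A)` of the generator. -/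
def resolventSet (T : C0Semigroup X) : Set ℂ := {μ | ∃ R, T.IsResolventAt μ R}

open Classical in
/-- The resolvent operator `R(μ, A)` (by convention `0` if `μ ∉ ρ(A)`). -/
def resolvent (T : C0Semigroup X) (μ : ℂ) : X →L[ℂ] X :=
  if h : μ ∈ T.resolventSet then h.choose else 0

theorem resolvent_spec (T : C0Semigroup X) {μ : ℂ} (h : μ ∈ T.resolventSet) :
    T.IsResolventAt μ (T.resolvent μ) := by
  rw [resolvent, dif_pos h]
  exact h.choose_spec

theorem diffQuot_op (T : C0Semigroup X) (s t : ℝ≥0) (x : X) :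
    T.diffQuot s (T.op t x) = T.op t (T.diffQuot s x) := by
  have h : T.op s (T.op t x) = T.op t (T.op s x) := by
    rw [← ContinuousLinearMap.comp_apply, ← ContinuousLinearMap.comp_apply, ← T.op_add,
      ← T.op_add, add_comm]
  have h' : ∀ (r : ℝ) (z : X), T.op t (r • z) = r • T.op t z := fun r z => by
    rw [← Complex.coe_smul, map_smul, Complex.coe_smul]
  simp only [diffQuot, h, h', map_sub]

theorem op_mem_domain (T : C0Semigroup X) (t : ℝ≥0) (x : T.generator.domain) :
    ∃ h : T.op t x ∈ T.generator.domain,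
      T.generator ⟨T.op t x, h⟩ = T.op t (T.generator x) := by
  have key : Tendsto (fun s => T.diffQuot s (T.op t (x : X))) (𝓝[>] 0)
      (𝓝 (T.op t (T.generator x))) := by
    simp only [diffQuot_op]
    exact ((T.op t).continuous.tendsto _).comp (T.generator_spec x)
  exact ⟨⟨_, key⟩, tendsto_nhds_unique (T.generator_spec ⟨T.op t x, ⟨_, key⟩⟩) key⟩

theorem resolvent_op (T : C0Semigroup X) (μ : ℂ) (t : ℝ≥0) (x : X) :
    T.resolvent μ (T.op t x) = T.op t (T.resolvent μ x) := by
  by_cases hμ : μ ∈ T.resolventSet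
  · obtain ⟨h1, h2⟩ := T.resolvent_spec hμ
    obtain ⟨hx, hx'⟩ := h1 x
    obtain ⟨hy, hy'⟩ := T.op_mem_domain t ⟨T.resolvent μ x, hx⟩
    have h3 := h2 ⟨_, hy⟩
    rw [hy'] at h3
    simp only at h3
    rw [← map_smul, ← map_sub, hx'] at h3
    exact h3
  · simp [resolvent, hμ]

/-- `‖T(t)‖ ≤ M e^{-ωt}` for all `t > 0`. -/
def HasExpDecay (T : C0Semigroup X) (M ω : ℝ) : Prop :=
  ∀ t : ℝ≥0, 0 < t → ‖T.op t‖ ≤ M * Real.exp (-ω * t)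

end Basic

/-! ### The Favard class -/

section Favard

variable {Y : Type*} [NormedAddCommGroup Y] [NormedSpace ℂ Y]

/-- The Favard class `{y : sup_{t > 0} ‖(1/t) (S(t)y - y)‖ < ∞}` of a semigroup. -/
def favardClass (S : C0Semigroup Y) : Submodule ℂ Y where
  carrier := {y | BddAbove (Set.range fun t : {t : ℝ≥0 // 0 < t} => ‖S.diffQuot t y‖)}
  add_mem' := by
    rintro a b ⟨K, hK⟩ ⟨L, hL⟩
    refine ⟨K + L, ?_⟩
    rintro _ ⟨t, rfl⟩
    simp only [diffQuot_add]
    exact (norm_add_le _ _).trans (add_le_add (hK ⟨t, rfl⟩) (hL ⟨t, rfl⟩))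
  zero_mem' := ⟨0, by rintro _ ⟨t, rfl⟩; simp [diffQuot]⟩
  smul_mem' := by
    rintro c a ⟨K, hK⟩
    refine ⟨‖c‖ * K, ?_⟩
    rintro _ ⟨t, rfl⟩
    simp only [diffQuot_smul, norm_smul]
    exact mul_le_mul_of_nonneg_left (hK ⟨t, rfl⟩) (norm_nonneg c)

/-- The Favard class as a space of its own, to carry the norm
`‖y‖ = sup_{t > 0} ‖(1/t) (S(t)y - y)‖` (and not the norm of the ambient space). -/
def FavardSpace (S : C0Semigroup Y) : Type _ := S.favardClass

instance (S : C0Semigroup Y) : AddCommGroup (FavardSpace S) :=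
  inferInstanceAs (AddCommGroup S.favardClass)

instance (S : C0Semigroup Y) : Module ℂ (FavardSpace S) :=
  inferInstanceAs (Module ℂ S.favardClass)

/-- The inclusion of the Favard class into the ambient space, as a linear map. -/
def favardIncl (S : C0Semigroup Y) : FavardSpace S →ₗ[ℂ] Y := S.favardClass.subtype

instance (S : C0Semigroup Y) : Norm (FavardSpace S) where
  norm y := ⨆ t : {t : ℝ≥0 // 0 < t}, ‖S.diffQuot t (S.favardIncl y)‖

theorem favard_norm_def (S : C0Semigroup Y) (y : FavardSpace S) :
    ‖y‖ = ⨆ t : {t : ℝ≥0 // 0 < t}, ‖S.diffQuot t (S.favardIncl y)‖ := rfl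

theorem favard_le_norm (S : C0Semigroup Y) (y : FavardSpace S) (t : {t : ℝ≥0 // 0 < t}) :
    ‖S.diffQuot t (S.favardIncl y)‖ ≤ ‖y‖ :=
  le_ciSup (f := fun t : {t : ℝ≥0 // 0 < t} => ‖S.diffQuot t (S.favardIncl y)‖) y.2 t

theorem favardCore (S : C0Semigroup Y) : SeminormedSpace.Core ℂ (FavardSpace S) where
  norm_nonneg y := Real.iSup_nonneg fun _ => norm_nonneg _
  norm_smul c y := by
    simp only [favard_norm_def, map_smul, diffQuot_smul, norm_smul]
    rw [Real.mul_iSup_of_nonneg (norm_nonneg c)]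
  norm_triangle x y := by
    have : Nonempty {t : ℝ≥0 // 0 < t} := ⟨⟨1, one_pos⟩⟩
    rw [favard_norm_def S (x + y)]
    refine ciSup_le fun t => ?_
    rw [map_add, diffQuot_add]
    exact (norm_add_le _ _).trans (add_le_add (favard_le_norm S x t) (favard_le_norm S y t))

instance (S : C0Semigroup Y) : SeminormedAddCommGroup (FavardSpace S) :=
  SeminormedAddCommGroup.ofCore (favardCore S)

instance (S : C0Semigroup Y) : NormedSpace ℂ (FavardSpace S) where
  norm_smul_le c y := ((favardCore S).norm_smul c y).le

theorem exists_favardIncl_bound (S : C0Semigroup Y) {M ω : ℝ} (hω : 0 < ω)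
    (hS : S.HasExpDecay M ω) : ∃ K : ℝ, ∀ y : FavardSpace S, ‖S.favardIncl y‖ ≤ K * ‖y‖ := by
  have h0 : Tendsto (fun t : ℝ => M * Real.exp (-ω * t)) atTop (𝓝 0) := by
    have h1 : Tendsto (fun t : ℝ => -ω * t) atTop atBot :=
      tendsto_id.const_mul_atTop_of_neg (by linarith)
    simpa using (Real.tendsto_exp_atBot.comp h1).const_mul M
  obtain ⟨t, ht, htp⟩ :=
    ((h0.eventually (gt_mem_nhds (show (0 : ℝ) < 1 / 2 by norm_num))).and
      (eventually_gt_atTop 0)).exists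
  lift t to ℝ≥0 using htp.le
  have htp' : 0 < t := by exact_mod_cast htp
  refine ⟨2 * t, fun y => ?_⟩
  set z : Y := S.favardIncl y with hz
  have h2 : ‖S.op t z‖ ≤ 1 / 2 * ‖z‖ :=
    ((S.op t).le_opNorm z).trans
      (mul_le_mul_of_nonneg_right ((hS t htp').trans ht.le) (norm_nonneg z))
  have h3 : ‖S.op t z - z‖ ≤ t * ‖y‖ := by
    have h4 := favard_le_norm S y ⟨t, htp'⟩
    rw [diffQuot, norm_smul, norm_inv, Real.norm_of_nonneg htp.le, inv_mul_le_iff₀ htp] at h4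
    exact h4
  have h5 : ‖z‖ ≤ ‖S.op t z - z‖ + ‖S.op t z‖ := by
    have := norm_sub_le (S.op t z) (S.op t z - z)
    rw [sub_sub_cancel] at this
    linarith
  linarith

/-- For a uniformly exponentially stable semigroup, the Favard class is continuously embedded. -/
def favardInclL (S : C0Semigroup Y) {M ω : ℝ} (hω : 0 < ω) (hS : S.HasExpDecay M ω) :
    FavardSpace S →L[ℂ] Y :=
  S.favardIncl.mkContinuousOfExistsBound (S.exists_favardIncl_bound hω hS)

end Favard

/-! ### The extrapolation space and the extrapolated semigroup -/

section Extrapolation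

variable {X : Type*} [NormedAddCommGroup X] [NormedSpace ℂ X]

/-- The space `X`, to be equipped with the norm `‖x‖₋₁ = ‖R(μ, A) x‖`. -/
def PreExtrap (_T : C0Semigroup X) (_μ : ℂ) : Type _ := X

instance (T : C0Semigroup X) (μ : ℂ) : AddCommGroup (PreExtrap T μ) :=
  inferInstanceAs (AddCommGroup X)

instance (T : C0Semigroup X) (μ : ℂ) : Module ℂ (PreExtrap T μ) :=
  inferInstanceAs (Module ℂ X)

/-- `R(μ, A)` as a linear map on `PreExtrap T μ`. -/
def preResolvent (T : C0Semigroup X) (μ : ℂ) : PreExtrap T μ →ₗ[ℂ] X :=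
  (T.resolvent μ : X →ₗ[ℂ] X)

instance (T : C0Semigroup X) (μ : ℂ) : SeminormedAddCommGroup (PreExtrap T μ) :=
  SeminormedAddCommGroup.induced (PreExtrap T μ) X (T.preResolvent μ)

instance (T : C0Semigroup X) (μ : ℂ) : NormedSpace ℂ (PreExtrap T μ) :=
  NormedSpace.induced ℂ (PreExtrap T μ) X (T.preResolvent μ)

/-- The extrapolation space `X₋₁`: the completion of `X` with respect to
`‖x‖₋₁ = ‖R(μ, A) x‖`, where `μ ∈ ρ(A)`. -/
def Extrap (T : C0Semigroup X) (μ : ℂ) : Type _ := UniformSpace.Completion (PreExtrap T μ)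

instance (T : C0Semigroup X) (μ : ℂ) : NormedAddCommGroup (Extrap T μ) :=
  inferInstanceAs (NormedAddCommGroup (UniformSpace.Completion (PreExtrap T μ)))

instance (T : C0Semigroup X) (μ : ℂ) : NormedSpace ℂ (Extrap T μ) :=
  inferInstanceAs (NormedSpace ℂ (UniformSpace.Completion (PreExtrap T μ)))

instance (T : C0Semigroup X) (μ : ℂ) : CompleteSpace (Extrap T μ) :=
  inferInstanceAs (CompleteSpace (UniformSpace.Completion (PreExtrap T μ)))

/-- The canonical embedding `X → X₋₁`. -/
def toExtrap (T : C0Semigroup X) (μ : ℂ) : X →L[ℂ] Extrap T μ :=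
  (UniformSpace.Completion.toComplL : PreExtrap T μ →L[ℂ] UniformSpace.Completion _).comp
    (LinearMap.mkContinuous (LinearMap.id : X →ₗ[ℂ] X) ‖T.resolvent μ‖
      (fun x => (T.resolvent μ).le_opNorm x) : X →L[ℂ] PreExtrap T μ)

theorem norm_toExtrap (T : C0Semigroup X) (μ : ℂ) (x : X) :
    ‖T.toExtrap μ x‖ = ‖T.resolvent μ x‖ :=
  UniformSpace.Completion.norm_coe (E := PreExtrap T μ) x

theorem denseRange_toExtrap (T : C0Semigroup X) (μ : ℂ) : DenseRange (T.toExtrap μ) :=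
  UniformSpace.Completion.denseRange_coe (α := PreExtrap T μ)

theorem norm_resolvent_op_le (T : C0Semigroup X) (μ : ℂ) (t : ℝ≥0) (x : X) :
    ‖T.resolvent μ (T.op t x)‖ ≤ ‖T.op t‖ * ‖T.resolvent μ x‖ := by
  rw [resolvent_op]
  exact (T.op t).le_opNorm _

/-- `T(t)` on `X` with the norm `‖·‖₋₁`. -/
def preExtrapOp (T : C0Semigroup X) (μ : ℂ) (t : ℝ≥0) : PreExtrap T μ →L[ℂ] PreExtrap T μ :=
  LinearMap.mkContinuous (T.op t : X →ₗ[ℂ] X) ‖T.op t‖ (T.norm_resolvent_op_le μ t)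

/-- The operator `T₋₁(t)`: the continuous extension of `T(t)` to `X₋₁`. -/
def extrapOp (T : C0Semigroup X) (μ : ℂ) (t : ℝ≥0) : Extrap T μ →L[ℂ] Extrap T μ :=
  (T.preExtrapOp μ t).completion

theorem extrapOp_toExtrap (T : C0Semigroup X) (μ : ℂ) (t : ℝ≥0) (x : X) :
    T.extrapOp μ t (T.toExtrap μ x) = T.toExtrap μ (T.op t x) :=
  UniformSpace.Completion.map_coe (T.preExtrapOp μ t).uniformContinuous x

theorem norm_extrapOp_le (T : C0Semigroup X) (μ : ℂ) (t : ℝ≥0) :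
    ‖T.extrapOp μ t‖ ≤ ‖T.op t‖ := by
  refine ContinuousLinearMap.opNorm_le_bound _ (norm_nonneg _) fun y => ?_
  induction y using (T.denseRange_toExtrap μ).induction_on with
  | hp => exact isClosed_le (by fun_prop) (by fun_prop)
  | ih x =>
    rw [extrapOp_toExtrap, norm_toExtrap, norm_toExtrap, resolvent_op]
    exact (T.op t).le_opNorm _

theorem exists_bound_Icc [CompleteSpace X] (T : C0Semigroup X) (a : ℝ≥0) :
    ∃ K : ℝ, ∀ t ≤ a, ‖T.op t‖ ≤ K := by
  obtain ⟨K, hK⟩ := banach_steinhaus (g := fun t : Set.Icc (0 : ℝ≥0) a => T.op t) (fun x => by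
    obtain ⟨C, hC⟩ := isCompact_Icc.exists_bound_of_continuousOn (s := Set.Icc (0 : ℝ≥0) a)
      (T.strongly_continuous x).continuousOn
    exact ⟨C, fun t => hC t t.2⟩)
  exact ⟨K, fun t ht => hK ⟨t, zero_le, ht⟩⟩

/-- The extrapolated semigroup `(T₋₁(t))_{t ≥ 0}` on `X₋₁`. -/
def extrap [CompleteSpace X] (T : C0Semigroup X) (μ : ℂ) : C0Semigroup (Extrap T μ) where
  op := T.extrapOp μ
  op_zero := by
    refine ContinuousLinearMap.ext fun y => ?_
    induction y using (T.denseRange_toExtrap μ).induction_on with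
    | hp => exact isClosed_eq (by fun_prop) (by fun_prop)
    | ih x => simp [extrapOp_toExtrap, T.op_zero]
  op_add s t := by
    refine ContinuousLinearMap.ext fun y => ?_
    induction y using (T.denseRange_toExtrap μ).induction_on with
    | hp => exact isClosed_eq (by fun_prop) (by fun_prop)
    | ih x => simp [extrapOp_toExtrap, T.op_add]
  strongly_continuous y := by
    refine continuous_iff_continuousAt.2 fun t₀ => ?_
    obtain ⟨K, hK⟩ := T.exists_bound_Icc (t₀ + 1)
    have hK0 : 0 ≤ K := (norm_nonneg _).trans (hK 0 zero_le)
    refine Metric.continuousAt_iff'.2 fun ε hε => ?_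
    obtain ⟨x, hx⟩ := (T.denseRange_toExtrap μ).exists_dist_lt y
      (show 0 < ε / (3 * (K + 1)) by positivity)
    have hb : ∀ t ≤ t₀ + 1,
        dist (T.extrapOp μ t y) (T.extrapOp μ t (T.toExtrap μ x)) < ε / 3 := by
      intro t ht
      rw [dist_eq_norm, ← map_sub]
      calc ‖T.extrapOp μ t (y - T.toExtrap μ x)‖
          ≤ ‖T.extrapOp μ t‖ * ‖y - T.toExtrap μ x‖ := (T.extrapOp μ t).le_opNorm _
        _ ≤ (K + 1) * ‖y - T.toExtrap μ x‖ :=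
          mul_le_mul_of_nonneg_right
            (((T.norm_extrapOp_le μ t).trans (hK t ht)).trans (by linarith)) (norm_nonneg _)
        _ < (K + 1) * (ε / (3 * (K + 1))) := by
          rw [← dist_eq_norm]
          exact mul_lt_mul_of_pos_left hx (by positivity)
        _ = ε / 3 := by field_simp
    have hc : Continuous fun t => T.extrapOp μ t (T.toExtrap μ x) := by
      simp only [extrapOp_toExtrap]
      exact (T.toExtrap μ).continuous.comp (T.strongly_continuous x)
    filter_upwards [Metric.continuousAt_iff'.1 hc.continuousAt (ε / 3) (by positivity),
      Iic_mem_nhds (show t₀ < t₀ + 1 from lt_add_of_pos_right _ one_pos)] with t h1 h2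
    have h3 := hb t h2
    have h4 := hb t₀ (le_add_of_nonneg_right zero_le)
    have h5 := dist_triangle4 (T.extrapOp μ t y) (T.extrapOp μ t (T.toExtrap μ x))
      (T.extrapOp μ t₀ (T.toExtrap μ x)) (T.extrapOp μ t₀ y)
    rw [dist_comm (T.extrapOp μ t₀ (T.toExtrap μ x))] at h5
    linarith

theorem HasExpDecay.extrap [CompleteSpace X] {T : C0Semigroup X} {M ω : ℝ}
    (h : T.HasExpDecay M ω) (μ : ℂ) : (T.extrap μ).HasExpDecay M ω :=
  fun t ht => (T.norm_extrapOp_le μ t).trans (h t ht)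

/-- The convolution `∫₀ᵗ T₋₁(t - s) f(s) ds`, a Bochner integral in `X₋₁`. -/
def extrapConv [CompleteSpace X] (T : C0Semigroup X) (μ : ℂ) (f : ℝ → Extrap T μ) (t : ℝ) :
    Extrap T μ :=
  ∫ s in (0 : ℝ)..t, (T.extrap μ).op (Real.toNNReal (t - s)) (f s)

/-- The Favard class `F₀` of the extrapolated semigroup, with the Favard norm. -/
abbrev F0 [CompleteSpace X] (T : C0Semigroup X) (μ : ℂ) : Type _ := FavardSpace (T.extrap μ)

/-- For all `f ∈ L¹_loc(ℝ₊, F₀)` and `t > 0` the convolution `∫₀ᵗ T₋₁(t - r) f(r) dr`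
belongs to `X` and
`‖∫₀ᵗ T₋₁(t - r) f(r) dr‖_X ≤ m ∫₀ᵗ e^{-ω(t - r)} ‖f(r)‖_{F₀} dr`. -/
def IsFavardConstant [CompleteSpace X] (T : C0Semigroup X) (μ : ℂ) (ω m : ℝ) : Prop :=
  ∀ f : ℝ → F0 T μ, LocallyIntegrableOn f (Set.Ici 0) → ∀ t : ℝ, 0 < t →
    ∃ x : X, T.toExtrap μ x = T.extrapConv μ (fun r => (T.extrap μ).favardIncl (f r)) t ∧
      ‖x‖ ≤ m * ∫ r in (0 : ℝ)..t, Real.exp (-ω * (t - r)) * ‖f r‖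

end Extrapolation

/-! ### Staffans–Weiss perturbations

`X`, `U`, `Z` are Banach spaces, `j : Z → X` is the embedding of `Z`, `B ∈ 𝓛(U, X₋₁)` and
`C ∈ 𝓛(Z, U)`. -/

section StaffansWeiss

/-- Lebesgue measure on the time interval `(0, t]`. -/
abbrev timeMeasure (t : ℝ) : Measure ℝ := volume.restrict (Set.Ioc 0 t)

/-- `L^p(0, t; U)`. -/
abbrev LpTime (U : Type*) [NormedAddCommGroup U] (p : ℝ≥0∞) (t : ℝ) : Type _ :=
  Lp U p (timeMeasure t)

/-- `f` is (the continuous representative of) an element of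
`W^{2,p}_0(0, t; U) = {f ∈ W^{2,p}(0, t; U) : f(0) = f'(0) = 0}`, with `f' = g` and `f'' = h`. -/
def MemW20 {U : Type*} [NormedAddCommGroup U] [NormedSpace ℂ U] (p : ℝ≥0∞) (t : ℝ)
    (f : ℝ → U) : Prop :=
  ∃ g h : ℝ → U, MemLp h p (timeMeasure t) ∧
    (∀ r ∈ Set.Icc 0 t, g r = ∫ s in (0 : ℝ)..r, h s) ∧
    ∀ r ∈ Set.Icc 0 t, f r = ∫ s in (0 : ℝ)..r, g s

variable {X U Z : Type*}
  [NormedAddCommGroup X] [NormedSpace ℂ X] [CompleteSpace X]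
  [NormedAddCommGroup U] [NormedSpace ℂ U]
  [NormedAddCommGroup Z] [NormedSpace ℂ Z]

/-- `X₁ ↪ Z ↪ X` with continuous embeddings, where `X₁` is `D(A)` with the graph norm. -/
def IsIntermediate (T : C0Semigroup X) (j : Z →L[ℂ] X) : Prop :=
  Function.Injective j ∧ (∀ x ∈ T.generator.domain, x ∈ Set.range j) ∧
    ∃ c : ℝ, ∀ (z : Z) (h : j z ∈ T.generator.domain),
      ‖z‖ ≤ c * (‖j z‖ + ‖T.generator ⟨j z, h⟩‖)

/-- The triple `(A, B, C)` is compatible: `range (R(μ', A₋₁) B) ⊆ Z` for some `μ' ∈ ρ(A)`. -/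
def IsCompatible (T : C0Semigroup X) (μ : ℂ) (j : Z →L[ℂ] X) (B : U →L[ℂ] Extrap T μ) : Prop :=
  ∃ μ' ∈ T.resolventSet, ∀ u : U, ∃ z : Z,
    T.toExtrap μ (j z) = (T.extrap μ).resolvent μ' (B u)

/-- `B` is `p`-admissible. -/
def IsControlAdmissible (T : C0Semigroup X) (μ : ℂ) (B : U →L[ℂ] Extrap T μ) (p : ℝ≥0∞) : Prop :=
  ∃ t : ℝ, 0 < t ∧ ∀ u : LpTime U p t, ∃ x : X,
    T.toExtrap μ x = T.extrapConv μ (fun s => B (u s)) t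

/-- `C` is `p`-admissible; here `z s` is `T(s)x`, regarded as an element of `Z`. -/
def IsObservationAdmissible (T : C0Semigroup X) (j : Z →L[ℂ] X) (C : Z →L[ℂ] U)
    (p : ℝ≥0∞) : Prop :=
  ∃ M_C : ℝ, 0 ≤ M_C ∧ ∃ t : ℝ, 0 < t ∧ ∀ x ∈ T.generator.domain,
    ∃ z : ℝ → Z, (∀ s ∈ Set.Ioc 0 t, j (z s) = T.op s.toNNReal x) ∧
      ∫⁻ s in Set.Ioc 0 t, ‖C (z s)‖ₑ ^ p.toReal ≤ ENNReal.ofReal (M_C * ‖x‖ ^ p.toReal)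

/-- The pair `(B, C)` is `p`-admissible; here `z r` is `∫₀ʳ T₋₁(r - s) B u(s) ds`, regarded as an
element of `Z`. -/
def IsPairAdmissible (T : C0Semigroup X) (μ : ℂ) (j : Z →L[ℂ] X) (B : U →L[ℂ] Extrap T μ)
    (C : Z →L[ℂ] U) (p : ℝ≥0∞) : Prop :=
  ∃ M_BC : ℝ, 0 ≤ M_BC ∧ ∃ t : ℝ, 0 < t ∧ ∀ u : ℝ → U, MemW20 p t u →
    ∃ z : ℝ → Z,
      (∀ r ∈ Set.Ioc 0 t, T.toExtrap μ (j (z r)) = T.extrapConv μ (fun s => B (u s)) r) ∧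
      ∫⁻ r in Set.Ioc 0 t, ‖C (z r)‖ₑ ^ p.toReal ≤
        ENNReal.ofReal M_BC * ∫⁻ s in Set.Ioc 0 t, ‖u s‖ₑ ^ p.toReal

/-- `𝓒_t ∈ 𝓛(X, L^p(0, t; U))` is the observation map: the bounded extension of
`D(A) ∋ x ↦ C T(·) x`. -/
def IsObservationMap (T : C0Semigroup X) (j : Z →L[ℂ] X) (C : Z →L[ℂ] U) {p : ℝ≥0∞}
    [Fact (1 ≤ p)] {t : ℝ} (C_t : X →L[ℂ] LpTime U p t) : Prop :=
  ∀ x ∈ T.generator.domain, ∀ᵐ s ∂timeMeasure t,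
    ∃ z : Z, j z = T.op s.toNNReal x ∧ C_t x s = C z

/-- `𝓕_t ∈ 𝓛(L^p(0, t; U))` is the input-output map: the bounded extension of
`W^{2,p}_0(0, t; U) ∋ u ↦ C ∫₀^· T₋₁(· - s) B u(s) ds`. -/
def IsInputOutputMap (T : C0Semigroup X) (μ : ℂ) (j : Z →L[ℂ] X) (B : U →L[ℂ] Extrap T μ)
    (C : Z →L[ℂ] U) {p : ℝ≥0∞} [Fact (1 ≤ p)] {t : ℝ}
    (F_t : LpTime U p t →L[ℂ] LpTime U p t) : Prop :=
  ∀ f : ℝ → U, MemW20 p t f → ∀ u : LpTime U p t, u =ᵐ[timeMeasure t] f →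
    ∀ᵐ r ∂timeMeasure t, ∃ z : Z,
      T.toExtrap μ (j z) = T.extrapConv μ (fun s => B (f s)) r ∧ F_t u r = C z

/-- `(B, C)` is a Staffans–Weiss perturbation of `A`, with exponent `p`. -/
structure IsStaffansWeissWith (T : C0Semigroup X) (μ : ℂ) (j : Z →L[ℂ] X)
    (B : U →L[ℂ] Extrap T μ) (C : Z →L[ℂ] U) (p : ℝ≥0∞) [Fact (1 ≤ p)] : Prop where
  intermediate : T.IsIntermediate j
  compatible : T.IsCompatible μ j B
  control : T.IsControlAdmissible μ B p
  observation : T.IsObservationAdmissible j C p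
  pair : T.IsPairAdmissible μ j B C p
  invertible : ∃ t : ℝ, 0 < t ∧ ∃ F_t : LpTime U p t →L[ℂ] LpTime U p t,
    T.IsInputOutputMap μ j B C F_t ∧ IsUnit (1 - F_t)

/-- `B` is infinite-time `p`-admissible. -/
def IsInfiniteTimeControlAdmissible (T : C0Semigroup X) (μ : ℂ) (B : U →L[ℂ] Extrap T μ)
    (p : ℝ≥0∞) [Fact (1 ≤ p)] : Prop :=
  ∃ M_B : ℝ, 0 ≤ M_B ∧ ∀ t : ℝ, 0 < t → ∀ u : LpTime U p t, ∃ x : X,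
    T.toExtrap μ x = T.extrapConv μ (fun s => B (u s)) t ∧ ‖x‖ ≤ M_B * ‖u‖

/-- `(B, C)` is an infinite-time Staffans–Weiss perturbation of `A`: for some `1 ≤ p < ∞` it is a
Staffans–Weiss perturbation, `B` is infinite-time `p`-admissible and
`sup_{t > 0} ‖(I - 𝓕_t)⁻¹ 𝓒_t‖ < ∞`. -/
def IsInfiniteTimeStaffansWeiss (T : C0Semigroup X) (μ : ℂ) (j : Z →L[ℂ] X)
    (B : U →L[ℂ] Extrap T μ) (C : Z →L[ℂ] U) : Prop :=
  ∃ (p : ℝ≥0∞) (_ : Fact (1 ≤ p)), p ≠ ∞ ∧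
    T.IsStaffansWeissWith μ j B C p ∧
    T.IsInfiniteTimeControlAdmissible μ B p ∧
    ∃ K : ℝ, ∀ t : ℝ, 0 < t →
      ∃ (F_t : LpTime U p t →L[ℂ] LpTime U p t) (C_t : X →L[ℂ] LpTime U p t),
        T.IsInputOutputMap μ j B C F_t ∧ T.IsObservationMap j C C_t ∧ IsUnit (1 - F_t) ∧
          ‖(Ring.inverse (1 - F_t)).comp C_t‖ ≤ K

end StaffansWeiss

end C0Semigroup

end

/-!
The theorem is proved with exponent `p = 1`.

The resolvent `R(μ, A)` extends to an isometry `X₋₁ → X` that intertwines the two semigroups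
(`extrapResolvent`). An element `y` of `X₋₁` lies in `X` as soon as its image `w` lies in `D(A)`,
and then it is `μw - Aw` (`toExtrap_eq_of_mem_domain`). Questions about `∫₀ᵗ T₋₁(t - r) f(r) dr ∈ X`
thus become questions about convolutions in `X` taking values in `D(A)`.

*Existence of `m`.* If `f` takes values in the Favard class, the difference quotients of
`w = ∫₀ᵗ T(t - r) f(r) dr` are bounded by `M ∫₀ᵗ e^{-ω(t - r)} ‖f(r)‖ dr`. This bounds `Aw` once
`w ∈ D(A)` is known (`norm_generator_le`). It also shows that the `f` with `w ∈ D(A)` form a closed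
subspace of `L¹` (`conv_mem_domain_of_approx`). That subspace contains the indicators of half-lines,
for which `w` is an integral of an orbit, hence by a Dynkin class argument all indicators, hence all
of `L¹` (`conv_mem_domain`).

*Perturbation.* By `IsFavardConstant` and Young's inequality for the kernel `e^{-ωs}`, whose integral
is `1 / ω`, the map `u ↦ ∫₀^· T₋₁(· - s) B u(s) ds` on `L¹(0, t; X)` has norm at most
`m ‖B‖ / ω < 1`, for every
`t` (`exists_inputOutput`), and `x ↦ T(·)x` has norm at most `M / ω` (`exists_observation`). The
Neumann series then bounds `(1 - 𝓕_t)⁻¹ 𝓒_t` uniformly in `t`.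
-/

noncomputable section

namespace C0Semigroup

/-! ### Orbits and convolutions of a semigroup -/

section Semigroup

variable {X : Type*} [NormedAddCommGroup X] [NormedSpace ℂ X]

theorem op_op (T : C0Semigroup X) (s t : ℝ≥0) (x : X) :
    T.op s (T.op t x) = T.op (s + t) x := by
  rw [T.op_add]; rfl

/-- The decay estimate also holds at `t = 0`, by strong continuity. -/
theorem HasExpDecay.norm_op_apply_le {T : C0Semigroup X} {M ω : ℝ} (hT : T.HasExpDecay M ω)
    (t : ℝ≥0) (x : X) : ‖T.op t x‖ ≤ M * Real.exp (-ω * t) * ‖x‖ := by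
  have hpos : ∀ t : ℝ≥0, 0 < t → ‖T.op t x‖ ≤ M * Real.exp (-ω * t) * ‖x‖ := fun t ht =>
    ((T.op t).le_opNorm x).trans (mul_le_mul_of_nonneg_right (hT t ht) (norm_nonneg x))
  rcases eq_or_lt_of_le (zero_le (a := t)) with rfl | ht
  · have h1 : Tendsto (fun s : ℝ≥0 => ‖T.op s x‖) (𝓝[>] 0) (𝓝 ‖T.op 0 x‖) :=
      ((T.strongly_continuous x).norm.tendsto 0).mono_left nhdsWithin_le_nhds
    have h2 : Tendsto (fun s : ℝ≥0 => M * Real.exp (-ω * s) * ‖x‖) (𝓝[>] 0)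
        (𝓝 (M * Real.exp (-ω * (0 : ℝ≥0)) * ‖x‖)) := by
      have h3 : Continuous fun s : ℝ≥0 => M * Real.exp (-ω * s) * ‖x‖ := by fun_prop
      exact (h3.tendsto 0).mono_left nhdsWithin_le_nhds
    exact le_of_tendsto_of_tendsto h1 h2
      (eventually_nhdsWithin_of_forall fun s hs => hpos s hs)
  · exact hpos t ht

theorem HasExpDecay.nonneg {T : C0Semigroup X} {M ω : ℝ} (hT : T.HasExpDecay M ω) : 0 ≤ M :=
  nonneg_of_mul_nonneg_left ((norm_nonneg _).trans (hT 1 one_pos)) (Real.exp_pos _)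

theorem HasExpDecay.norm_op_apply_le_const {T : C0Semigroup X} {M ω : ℝ} (hω : 0 < ω)
    (hT : T.HasExpDecay M ω) (t : ℝ≥0) (x : X) : ‖T.op t x‖ ≤ M * ‖x‖ := by
  refine (hT.norm_op_apply_le t x).trans (mul_le_mul_of_nonneg_right ?_ (norm_nonneg x))
  refine mul_le_of_le_one_right hT.nonneg (Real.exp_le_one_iff.2 ?_)
  have : 0 ≤ ω * t := mul_nonneg hω.le t.2
  linarith

/-- A semigroup is jointly continuous in time and space. -/
theorem HasExpDecay.continuous_op {T : C0Semigroup X} {M ω : ℝ} (hω : 0 < ω)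
    (hT : T.HasExpDecay M ω) : Continuous fun p : ℝ≥0 × X => T.op p.1 p.2 := by
  refine continuous_iff_continuousAt.2 fun ⟨t₀, x₀⟩ => ?_
  have h1 : Tendsto (fun p : ℝ≥0 × X => T.op p.1 (p.2 - x₀)) (𝓝 (t₀, x₀)) (𝓝 0) := by
    refine squeeze_zero_norm (a := fun p => M * ‖p.2 - x₀‖)
      (fun p => hT.norm_op_apply_le_const hω _ _) ?_
    have : Continuous fun p : ℝ≥0 × X => M * ‖p.2 - x₀‖ := by fun_prop
    simpa using this.tendsto (t₀, x₀)
  have h2 : Tendsto (fun p : ℝ≥0 × X => T.op p.1 x₀) (𝓝 (t₀, x₀)) (𝓝 (T.op t₀ x₀)) :=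
    ((T.strongly_continuous x₀).comp continuous_fst).tendsto (t₀, x₀)
  have h3 := h1.add h2
  simp only [map_sub, sub_add_cancel, zero_add] at h3
  exact h3

/-- The difference quotient as a bounded operator. -/
def diffQuotL (T : C0Semigroup X) (h : ℝ≥0) : X →L[ℂ] X :=
  (h : ℝ)⁻¹ • (T.op h - ContinuousLinearMap.id ℂ X)

theorem diffQuotL_apply (T : C0Semigroup X) (h : ℝ≥0) (x : X) :
    T.diffQuotL h x = T.diffQuot h x := rfl

theorem diffQuot_sub (T : C0Semigroup X) (h : ℝ≥0) (x y : X) :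
    T.diffQuot h (x - y) = T.diffQuot h x - T.diffQuot h y := by
  simp only [← diffQuotL_apply, map_sub]

theorem mem_domain_of_tendsto (T : C0Semigroup X) {x y : X}
    (h : Tendsto (fun t => T.diffQuot t x) (𝓝[>] 0) (𝓝 y)) :
    ∃ hx : x ∈ T.generator.domain, T.generator ⟨x, hx⟩ = y :=
  ⟨⟨y, h⟩, tendsto_nhds_unique (T.generator_spec ⟨x, ⟨y, h⟩⟩) h⟩

/-- The bounds on the difference quotients pass to the generator. -/
theorem norm_generator_le (T : C0Semigroup X) (x : T.generator.domain) {c : ℝ}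
    (h : ∀ t : ℝ≥0, 0 < t → ‖T.diffQuot t (x : X)‖ ≤ c) : ‖T.generator x‖ ≤ c :=
  le_of_tendsto (T.generator_spec x).norm (eventually_nhdsWithin_of_forall h)

/-- The domain of the generator is closed for the seminorm
`sup_{h > 0} ‖(1/h) (T(h)x - x)‖` of the Favard class. -/
theorem mem_domain_of_approx [CompleteSpace X] (T : C0Semigroup X) (w : X)
    (H : ∀ ε : ℝ, 0 < ε → ∃ v ∈ T.generator.domain,
      ∀ h : ℝ≥0, 0 < h → ‖T.diffQuot h (w - v)‖ ≤ ε) : w ∈ T.generator.domain := by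
  refine cauchy_map_iff_exists_tendsto.1 (Metric.cauchy_iff.2 ⟨inferInstance, fun ε hε => ?_⟩)
  obtain ⟨v, hv, hwv⟩ := H (ε / 5) (by positivity)
  have h1 := Metric.tendsto_nhds.1 (T.generator_spec ⟨v, hv⟩) (ε / 5) (by positivity)
  refine ⟨(fun t => T.diffQuot t w) ''
    ({t | dist (T.diffQuot t v) (T.generator ⟨v, hv⟩) < ε / 5} ∩ Set.Ioi 0),
    image_mem_map (inter_mem h1 self_mem_nhdsWithin), ?_⟩
  have key : ∀ t ∈ {t | dist (T.diffQuot t v) (T.generator ⟨v, hv⟩) < ε / 5} ∩ Set.Ioi 0,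
      dist (T.diffQuot t w) (T.generator ⟨v, hv⟩) < 2 * (ε / 5) := by
    rintro t ⟨ht, ht0⟩
    have h2 := hwv t ht0
    rw [diffQuot_sub, ← dist_eq_norm] at h2
    have h3 := dist_triangle (T.diffQuot t w) (T.diffQuot t v) (T.generator ⟨v, hv⟩)
    have h4 : dist (T.diffQuot t v) (T.generator ⟨v, hv⟩) < ε / 5 := ht
    linarith
  rintro _ ⟨s, hs, rfl⟩ _ ⟨t, ht, rfl⟩
  have := dist_triangle_right (T.diffQuot s w) (T.diffQuot t w) (T.generator ⟨v, hv⟩)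
  have := key s hs
  have := key t ht
  linarith

/-- The convolution `∫₀ᵗ T(t - s) f(s) ds`. -/
def conv (T : C0Semigroup X) (f : ℝ → X) (t : ℝ) : X :=
  ∫ s in (0 : ℝ)..t, T.op (Real.toNNReal (t - s)) (f s)

theorem conv_eq (T : C0Semigroup X) (f : ℝ → X) {t : ℝ} (ht : 0 ≤ t) :
    T.conv f t = ∫ s, T.op (Real.toNNReal (t - s)) (f s) ∂timeMeasure t :=
  intervalIntegral.integral_of_le ht

theorem conv_congr (T : C0Semigroup X) {f g : ℝ → X} {t : ℝ} (ht : 0 ≤ t)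
    (h : f =ᵐ[timeMeasure t] g) : T.conv f t = T.conv g t := by
  rw [conv_eq T f ht, conv_eq T g ht]
  exact integral_congr_ae (h.mono fun s hs => by simp only [hs])

theorem HasExpDecay.integrable_conv {T : C0Semigroup X} {M ω : ℝ} (hω : 0 < ω)
    (hT : T.HasExpDecay M ω) {f : ℝ → X} {t : ℝ} {ν : Measure ℝ} (hf : Integrable f ν) :
    Integrable (fun s => T.op (Real.toNNReal (t - s)) (f s)) ν := by
  refine (hf.norm.const_mul M).mono' ?_
    (Eventually.of_forall fun s => hT.norm_op_apply_le_const hω _ _)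
  have h1 : AEStronglyMeasurable (fun s : ℝ => Real.toNNReal (t - s)) ν :=
    Continuous.aestronglyMeasurable (by fun_prop)
  exact (hT.continuous_op hω).comp_aestronglyMeasurable (h1.prodMk hf.1)

theorem HasExpDecay.conv_add {T : C0Semigroup X} {M ω : ℝ} (hω : 0 < ω)
    (hT : T.HasExpDecay M ω) {f g : ℝ → X} {t : ℝ} (ht : 0 ≤ t)
    (hf : Integrable f (timeMeasure t)) (hg : Integrable g (timeMeasure t)) :
    T.conv (fun s => f s + g s) t = T.conv f t + T.conv g t := by
  simp only [conv_eq _ _ ht, map_add]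
  exact integral_add (hT.integrable_conv hω hf) (hT.integrable_conv hω hg)

theorem conv_smul (T : C0Semigroup X) (c : ℂ) (f : ℝ → X) (t : ℝ) :
    T.conv (fun s => c • f s) t = c • T.conv f t := by
  simp only [conv, map_smul, intervalIntegral.integral_smul]

/-- A bounded operator that intertwines two semigroups intertwines their convolutions. -/
theorem HasExpDecay.map_conv {Y : Type*} [NormedAddCommGroup Y] [NormedSpace ℂ Y]
    [CompleteSpace X] [CompleteSpace Y] {S : C0Semigroup Y} {T : C0Semigroup X} {M ω : ℝ}
    (hω : 0 < ω) (hS : S.HasExpDecay M ω) (R : Y →L[ℂ] X)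
    (hR : ∀ t y, R (S.op t y) = T.op t (R y)) {f : ℝ → Y} {t : ℝ} (ht : 0 ≤ t)
    (hf : Integrable f (timeMeasure t)) : R (S.conv f t) = T.conv (fun s => R (f s)) t := by
  simp only [conv_eq _ _ ht, ← hR]
  exact (R.integral_comp_comm (hS.integrable_conv hω hf)).symm

theorem HasExpDecay.diffQuot_conv [CompleteSpace X] {T : C0Semigroup X} {M ω : ℝ} (hω : 0 < ω)
    (hT : T.HasExpDecay M ω) {f : ℝ → X} {t : ℝ} (ht : 0 ≤ t)
    (hf : Integrable f (timeMeasure t)) (h : ℝ≥0) :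
    T.diffQuot h (T.conv f t) = T.conv (fun s => T.diffQuot h (f s)) t :=
  hT.map_conv hω (T.diffQuotL h) (fun s y => T.diffQuot_op h s y) ht hf

theorem integrable_exp_mul {E : Type*} [NormedAddCommGroup E] (ω : ℝ) {t : ℝ} {f : ℝ → E}
    (hf : Integrable f (timeMeasure t)) :
    Integrable (fun s => Real.exp (-ω * (t - s)) * ‖f s‖) (timeMeasure t) := by
  have h1 : IntegrableOn (fun s => ‖f s‖) (Set.Ioc 0 t) := hf.norm
  obtain ⟨C, hC⟩ := isCompact_Icc.exists_bound_of_continuousOn (s := Set.Icc (0 : ℝ) t)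
    (f := fun s => Real.exp (-ω * (t - s))) (by fun_prop)
  refine Integrable.bdd_mul (c := C) h1 (Continuous.aestronglyMeasurable (by fun_prop)) ?_
  exact (ae_restrict_mem measurableSet_Ioc).mono fun s hs => hC s ⟨hs.1.le, hs.2⟩

theorem HasExpDecay.norm_conv_le {E : Type*} [NormedAddCommGroup E] {T : C0Semigroup X}
    {M ω : ℝ} (hT : T.HasExpDecay M ω) {f : ℝ → X} {g : ℝ → E} {t : ℝ} (ht : 0 ≤ t)
    (hfg : ∀ s, ‖f s‖ ≤ ‖g s‖) (hg : Integrable g (timeMeasure t)) :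
    ‖T.conv f t‖ ≤ M * ∫ s in (0 : ℝ)..t, Real.exp (-ω * (t - s)) * ‖g s‖ := by
  rw [conv_eq _ _ ht, intervalIntegral.integral_of_le ht, ← integral_const_mul]
  refine norm_integral_le_of_norm_le ((integrable_exp_mul ω hg).const_mul M)
    ((ae_restrict_mem measurableSet_Ioc).mono fun s hs => ?_)
  have h1 := hT.norm_op_apply_le (Real.toNNReal (t - s)) (f s)
  rw [Real.coe_toNNReal _ (sub_nonneg.2 hs.2), mul_assoc] at h1
  exact h1.trans (mul_le_mul_of_nonneg_left
    (mul_le_mul_of_nonneg_left (hfg s) (Real.exp_pos _).le) hT.nonneg)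

theorem exp_mul_integral_le {E : Type*} [NormedAddCommGroup E] {ω : ℝ} (hω : 0 < ω) {t : ℝ}
    (ht : 0 ≤ t) {f : ℝ → E} (hf : Integrable f (timeMeasure t)) :
    ∫ s in (0 : ℝ)..t, Real.exp (-ω * (t - s)) * ‖f s‖ ≤ ∫ s, ‖f s‖ ∂timeMeasure t := by
  rw [intervalIntegral.integral_of_le ht]
  refine integral_mono_ae (integrable_exp_mul ω hf) hf.norm
    ((ae_restrict_mem measurableSet_Ioc).mono fun s hs => ?_)
  refine mul_le_of_le_one_left (norm_nonneg _) (Real.exp_le_one_iff.2 ?_)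
  have : 0 ≤ ω * (t - s) := mul_nonneg hω.le (sub_nonneg.2 hs.2)
  linarith

/-- `∫ₐᵇ T(s)x ds ∈ D(A)` for every `x`. -/
theorem integral_orbit_mem_domain [CompleteSpace X] (T : C0Semigroup X) (x : X) {a b : ℝ}
    (ha : 0 ≤ a) (hab : a ≤ b) :
    ∫ s in a..b, T.op (Real.toNNReal s) x ∈ T.generator.domain := by
  set v : ℝ → X := fun s => T.op (Real.toNNReal s) x with hv
  have hvc : Continuous v := (T.strongly_continuous x).comp continuous_real_toNNReal
  have hvi : ∀ c d : ℝ, IntervalIntegrable v volume c d := fun c d => hvc.intervalIntegrable c d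
  set G : ℝ → X := fun c => ∫ s in (0 : ℝ)..c, v s
  have hG : ∀ c, HasDerivAt G (v c) c := fun c => hvc.integral_hasStrictDerivAt 0 c |>.hasDerivAt
  -- `(1/h) (T(h) - 1) ∫ₐᵇ T(s)x ds = (1/h) ∫_b^{b+h} T(s)x ds - (1/h) ∫_a^{a+h} T(s)x ds`
  have hq : ∀ h : ℝ≥0, T.diffQuot h (∫ s in a..b, v s) =
      (h : ℝ)⁻¹ • (G (b + h) - G b) - (h : ℝ)⁻¹ • (G (a + h) - G a) := by
    intro h
    have h1 : T.op h (∫ s in a..b, v s) = ∫ s in (a + h)..(b + h), v s := by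
      rw [← intervalIntegral.integral_comp_add_right,
        ← ContinuousLinearMap.intervalIntegral_comp_comm _ (hvi a b)]
      refine intervalIntegral.integral_congr fun s hs => ?_
      rw [Set.uIcc_of_le hab] at hs
      simp only [hv, op_op]
      rw [Real.toNNReal_add (ha.trans hs.1) h.coe_nonneg, Real.toNNReal_coe, add_comm]
    have h2 : ∀ c d, ∫ s in c..d, v s = G d - G c := fun c d =>
      (intervalIntegral.integral_interval_sub_left (hvi 0 d) (hvi 0 c)).symm
    rw [diffQuot, h1, h2, h2, ← smul_sub]
    congr 1
    abel
  have ht : Tendsto (fun h : ℝ≥0 => (h : ℝ)) (𝓝[>] 0) (𝓝[>] 0) := by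
    refine tendsto_nhdsWithin_iff.2 ⟨?_, eventually_nhdsWithin_of_forall fun h hh => ?_⟩
    · exact (NNReal.continuous_coe.tendsto 0).mono_left nhdsWithin_le_nhds
    · exact NNReal.coe_pos.2 hh
  refine (T.mem_domain_of_tendsto (y := v b - v a) ?_).1
  simp only [hq]
  exact ((hG b).tendsto_slope_zero_right.comp ht).sub ((hG a).tendsto_slope_zero_right.comp ht)

/-- The difference quotients at `x ∈ D(A)` are controlled by `Ax`: the right derivative of
`t ↦ T(t)x` is `T(t)Ax`. -/
theorem HasExpDecay.norm_diffQuot_le {T : C0Semigroup X} {M ω : ℝ} (hω : 0 < ω)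
    (hT : T.HasExpDecay M ω) (x : T.generator.domain) (h : ℝ≥0) :
    ‖T.diffQuot h (x : X)‖ ≤ M * ‖T.generator x‖ := by
  have hc : Continuous fun s : ℝ => T.op (Real.toNNReal s) (x : X) :=
    (T.strongly_continuous (x : X)).comp continuous_real_toNNReal
  have hd : ∀ s ∈ Set.Ico (0 : ℝ) h, HasDerivWithinAt (fun s : ℝ => T.op (Real.toNNReal s) (x : X))
      (T.op (Real.toNNReal s) (T.generator x)) (Set.Ici s) s := by
    intro s hs
    refine hasDerivWithinAt_Ioi_iff_Ici.1 ?_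
    rw [hasDerivWithinAt_iff_tendsto_slope' (by simp)]
    have h1 := ((T.op (Real.toNNReal s)).continuous.tendsto _).comp (T.generator_spec x)
    have h2 : Tendsto (fun r : ℝ => Real.toNNReal (r - s)) (𝓝[>] s) (𝓝[>] 0) := by
      refine tendsto_nhdsWithin_iff.2 ⟨?_, eventually_nhdsWithin_of_forall fun r hr => ?_⟩
      · have h3 : Continuous fun r : ℝ => Real.toNNReal (r - s) := by fun_prop
        simpa using (h3.tendsto s).mono_left nhdsWithin_le_nhds
      · exact Real.toNNReal_pos.2 (sub_pos.2 hr)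
    refine (h1.comp h2).congr' (eventually_nhdsWithin_of_forall fun r hr => ?_)
    have hr' : 0 ≤ r - s := (sub_pos.2 hr).le
    simp only [Function.comp_apply, ← diffQuot_op]
    rw [diffQuot, op_op, ← Real.toNNReal_add hr' hs.1, sub_add_cancel, slope_def_module,
      Real.coe_toNNReal _ hr']
  have h1 := norm_image_sub_le_of_norm_deriv_right_le_segment hc.continuousOn hd
    (fun s _ => hT.norm_op_apply_le_const hω _ _) h ⟨h.2, le_rfl⟩
  rcases eq_or_lt_of_le (zero_le (a := h)) with rfl | hh
  · simpa [diffQuot] using mul_nonneg hT.nonneg (norm_nonneg _)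
  · have hh' : (0 : ℝ) < h := hh
    rw [diffQuot, norm_smul, norm_inv, Real.norm_of_nonneg hh'.le, inv_mul_le_iff₀ hh']
    simpa [T.op_zero, mul_comm] using h1

end Semigroup

/-! ### Convolutions of functions with values in the Favard class -/

section FavardConvolution

variable {X : Type*} [NormedAddCommGroup X] [NormedSpace ℂ X] [CompleteSpace X]
  {E : Type*} [NormedAddCommGroup E] [NormedSpace ℂ E]

theorem HasExpDecay.norm_diffQuot_conv_le {T : C0Semigroup X} {M ω : ℝ} (hω : 0 < ω)
    (hT : T.HasExpDecay M ω) (L : E →L[ℂ] X)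
    (hL : ∀ h : ℝ≥0, 0 < h → ∀ y, ‖T.diffQuot h (L y)‖ ≤ ‖y‖) {t : ℝ} (ht : 0 ≤ t) {f : ℝ → E}
    (hf : Integrable f (timeMeasure t)) {h : ℝ≥0} (hh : 0 < h) :
    ‖T.diffQuot h (T.conv (fun s => L (f s)) t)‖ ≤
      M * ∫ s in (0 : ℝ)..t, Real.exp (-ω * (t - s)) * ‖f s‖ := by
  rw [hT.diffQuot_conv hω ht (L.integrable_comp hf)]
  exact hT.norm_conv_le ht (fun s => hL h hh (f s)) hf

/-- The functions `f` with `∫₀ᵗ T(t - s) L f(s) ds ∈ D(A)` are closed under approximation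
in `L¹`. -/
theorem HasExpDecay.conv_mem_domain_of_approx {T : C0Semigroup X} {M ω : ℝ} (hω : 0 < ω)
    (hT : T.HasExpDecay M ω) (L : E →L[ℂ] X)
    (hL : ∀ h : ℝ≥0, 0 < h → ∀ y, ‖T.diffQuot h (L y)‖ ≤ ‖y‖) {t : ℝ} (ht : 0 ≤ t) {f : ℝ → E}
    (hf : Integrable f (timeMeasure t))
    (H : ∀ ε : ℝ, 0 < ε → ∃ g : ℝ → E, Integrable g (timeMeasure t) ∧
      T.conv (fun s => L (g s)) t ∈ T.generator.domain ∧
        ∫ s, ‖f s - g s‖ ∂timeMeasure t ≤ ε) :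
    T.conv (fun s => L (f s)) t ∈ T.generator.domain := by
  refine T.mem_domain_of_approx _ fun ε hε => ?_
  have hM : 0 < M + 1 := by linarith [hT.nonneg]
  obtain ⟨g, hg, hgd, hfg⟩ := H (ε / (M + 1)) (by positivity)
  refine ⟨_, hgd, fun h hh => ?_⟩
  have h1 : T.conv (fun s => L (f s)) t - T.conv (fun s => L (g s)) t =
      T.conv (fun s => L (f s - g s)) t := by
    have h2 : Integrable (fun s => L (f s - g s)) (timeMeasure t) :=
      L.integrable_comp (hf.sub hg)
    rw [sub_eq_iff_eq_add, ← hT.conv_add hω ht h2 (L.integrable_comp hg)]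
    simp
  rw [h1]
  refine (hT.norm_diffQuot_conv_le hω L hL ht (hf.sub hg) hh).trans ?_
  calc M * ∫ s in (0 : ℝ)..t, Real.exp (-ω * (t - s)) * ‖f s - g s‖
      ≤ (M + 1) * (ε / (M + 1)) := by
        refine mul_le_mul (by linarith) ((exp_mul_integral_le hω ht (hf.sub hg)).trans hfg) ?_
          hM.le
        exact intervalIntegral.integral_nonneg ht fun s _ => by positivity
    _ = ε := by field_simp

theorem HasExpDecay.conv_indicator_mem_domain {T : C0Semigroup X} {M ω : ℝ} (hω : 0 < ω)
    (hT : T.HasExpDecay M ω) (L : E →L[ℂ] X)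
    (hL : ∀ h : ℝ≥0, 0 < h → ∀ y, ‖T.diffQuot h (L y)‖ ≤ ‖y‖) {t : ℝ} (ht : 0 ≤ t) (y : E)
    {A : Set ℝ} (hA : MeasurableSet A) :
    T.conv (fun s => L (A.indicator (fun _ => y) s)) t ∈ T.generator.domain := by
  have hi : ∀ {A : Set ℝ}, MeasurableSet A →
      Integrable (A.indicator fun _ => y) (timeMeasure t) := fun hA =>
    (integrable_const y).indicator hA
  -- for an interval, the convolution is `∫ T(s) L y ds` over an interval
  have hIic : ∀ a : ℝ, T.conv (fun s => L ((Set.Iic a).indicator (fun _ => y) s)) t ∈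
      T.generator.domain := by
    intro a
    rcases lt_or_ge a 0 with ha | ha
    · have : T.conv (fun s => L ((Set.Iic a).indicator (fun _ => y) s)) t = 0 := by
        rw [conv_eq _ _ ht]
        refine integral_eq_zero_of_ae ((ae_restrict_mem measurableSet_Ioc).mono fun s hs => ?_)
        simp [Set.indicator_of_notMem (show s ∉ Set.Iic a from not_le.2 (ha.trans hs.1))]
      rw [this]
      exact T.generator.domain.zero_mem
    · have hb : 0 ≤ min a t := le_min ha ht
      have : T.conv (fun s => L ((Set.Iic a).indicator (fun _ => y) s)) t =
          ∫ s in (t - min a t)..t, T.op (Real.toNNReal s) (L y) := by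
        have h1 := intervalIntegral.integral_comp_sub_left
          (fun s => T.op (Real.toNNReal s) (L y)) t (a := 0) (b := min a t)
        rw [sub_zero] at h1
        rw [← h1, intervalIntegral.integral_of_le hb, conv_eq _ _ ht, timeMeasure]
        have h2 : Set.Ioc 0 (min a t) = Set.Iic a ∩ Set.Ioc 0 t := by
          ext s
          simp only [Set.mem_Ioc, Set.mem_inter_iff, Set.mem_Iic, le_min_iff]
          tauto
        rw [h2, ← Measure.restrict_restrict measurableSet_Iic,
          ← integral_indicator measurableSet_Iic]
        refine integral_congr_ae (Eventually.of_forall fun s => ?_)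
        by_cases hs : s ∈ Set.Iic a
        · simp only [Set.indicator_of_mem hs]
        · simp only [Set.indicator_of_notMem hs, map_zero]
      rw [this]
      exact T.integral_orbit_mem_domain _ (by linarith [min_le_right a t])
        (by linarith)
  have hadd : ∀ {f g : ℝ → E}, Integrable f (timeMeasure t) → Integrable g (timeMeasure t) →
      T.conv (fun s => L (f s + g s)) t =
        T.conv (fun s => L (f s)) t + T.conv (fun s => L (g s)) t := by
    intro f g hf hg
    simp only [map_add]
    exact hT.conv_add hω ht (L.integrable_comp hf) (L.integrable_comp hg)
  have huniv : T.conv (fun s => L ((Set.univ).indicator (fun _ => y) s)) t ∈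
      T.generator.domain := by
    have h1 : T.conv (fun s => L ((Set.univ).indicator (fun _ => y) s)) t =
        T.conv (fun s => L ((Set.Iic t).indicator (fun _ => y) s)) t := by
      refine T.conv_congr ht ((ae_restrict_mem measurableSet_Ioc).mono fun s hs => ?_)
      simp [Set.indicator_of_mem (show s ∈ Set.Iic t from hs.2)]
    rw [h1]
    exact hIic t
  induction A, hA using MeasurableSpace.induction_on_inter
    ((BorelSpace.measurable_eq (α := ℝ)).trans (borel_eq_generateFrom_Iic ℝ))
    isPiSystem_Iic with
  | empty => simp [conv, T.generator.domain.zero_mem]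
  | basic A hA =>
    obtain ⟨a, rfl⟩ := hA
    exact hIic a
  | compl A hA ih =>
    have h1 := hadd (hi hA) (hi hA.compl)
    simp only [Set.indicator_self_add_compl_apply] at h1
    simp only [Set.indicator_univ] at huniv
    rw [h1] at huniv
    exact (T.generator.domain.add_mem_iff_right ih).1 huniv
  | iUnion B hd hB ih =>
    have hC : ∀ n : ℕ, MeasurableSet (⋃ i ∈ Finset.range n, B i) := fun n =>
      Finset.measurableSet_biUnion _ fun i _ => hB i
    have hfin : ∀ n : ℕ, T.conv (fun s => L ((⋃ i ∈ Finset.range n, B i).indicator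
        (fun _ => y) s)) t ∈ T.generator.domain := by
      intro n
      have h1 : ∀ s, (⋃ i ∈ Finset.range n, B i).indicator (fun _ => y) s =
          ∑ i ∈ Finset.range n, (B i).indicator (fun _ => y) s := fun s =>
        congrFun (Finset.indicator_biUnion (Finset.range n) B (f := fun _ => y)
          (fun i _ j _ hij => hd hij)) s
      simp only [h1, map_sum, conv_eq _ _ ht]
      rw [integral_finsetSum _ fun i _ =>
        hT.integrable_conv hω (L.integrable_comp (hi (hB i)))]
      refine Submodule.sum_mem _ fun i _ => ?_
      rw [← conv_eq T (fun s => L ((B i).indicator (fun _ => y) s)) ht]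
      exact ih i
    refine hT.conv_mem_domain_of_approx hω L hL ht (hi (.iUnion hB)) fun ε hε => ?_
    have hlim : Tendsto (fun n : ℕ => ∫ s, ‖(⋃ i, B i).indicator (fun _ => y) s -
        (⋃ i ∈ Finset.range n, B i).indicator (fun _ => y) s‖ ∂timeMeasure t) atTop
        (𝓝 (∫ _, (0 : ℝ) ∂timeMeasure t)) := by
      refine tendsto_integral_of_dominated_convergence (fun _ => ‖y‖ + ‖y‖)
        (fun n => ((hi (.iUnion hB)).sub (hi (hC n))).norm.1) (integrable_const _)
        (fun n => Eventually.of_forall fun s => ?_) (Eventually.of_forall fun s => ?_)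
      · rw [norm_norm]
        exact (norm_sub_le _ _).trans (add_le_add (norm_indicator_le_norm_self _ _)
          (norm_indicator_le_norm_self _ _))
      · refine tendsto_const_nhds.congr' ?_
        by_cases hs : s ∈ ⋃ i, B i
        · obtain ⟨i, hsi⟩ := Set.mem_iUnion.1 hs
          filter_upwards [eventually_gt_atTop i] with n hn
          rw [Set.indicator_of_mem hs, Set.indicator_of_mem, sub_self, norm_zero]
          exact Set.mem_biUnion (Finset.mem_coe.2 (Finset.mem_range.2 hn)) hsi
        · refine Eventually.of_forall fun n => ?_
          have hs' : s ∉ ⋃ i ∈ Finset.range n, B i := fun h =>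
            hs (Set.iUnion₂_subset_iUnion _ _ h)
          simp only [Set.indicator_of_notMem hs, Set.indicator_of_notMem hs', sub_self, norm_zero]
    rw [integral_zero] at hlim
    obtain ⟨n, hn⟩ := (hlim.eventually (gt_mem_nhds hε)).exists
    exact ⟨_, hi (hC n), hfin n, hn.le⟩

/-- If `f` is integrable with values in (a space mapped by `L` into) the Favard class of a
semigroup, the convolution of the semigroup with `f` takes values in the domain of the
generator. This holds for indicator functions, and the functions for which it holds form a closed
subspace of `L¹`. -/
theorem HasExpDecay.conv_mem_domain {T : C0Semigroup X} {M ω : ℝ} (hω : 0 < ω)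
    (hT : T.HasExpDecay M ω) (L : E →L[ℂ] X)
    (hL : ∀ h : ℝ≥0, 0 < h → ∀ y, ‖T.diffQuot h (L y)‖ ≤ ‖y‖) {t : ℝ} (ht : 0 ≤ t) {f : ℝ → E}
    (hf : Integrable f (timeMeasure t)) :
    T.conv (fun s => L (f s)) t ∈ T.generator.domain := by
  refine Integrable.induction (fun f => T.conv (fun s => L (f s)) t ∈ T.generator.domain)
    ?_ ?_ ?_ ?_ hf
  · intro y A hA _
    exact hT.conv_indicator_mem_domain hω L hL ht y hA
  · intro f g _ hf hg ihf ihg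
    simp only [Pi.add_apply, map_add]
    rw [hT.conv_add hω ht (L.integrable_comp hf) (L.integrable_comp hg)]
    exact add_mem ihf ihg
  · refine isClosed_of_closure_subset fun f hf => ?_
    refine hT.conv_mem_domain_of_approx hω L hL ht (L1.integrable_coeFn f) fun ε hε => ?_
    obtain ⟨g, hg, hfg⟩ := Metric.mem_closure_iff.1 hf ε hε
    refine ⟨g, L1.integrable_coeFn g, hg, ?_⟩
    rw [dist_eq_norm, L1.norm_eq_integral_norm] at hfg
    refine le_trans (le_of_eq ?_) hfg.le
    exact integral_congr_ae ((Lp.coeFn_sub f g).mono fun s hs => congrArg norm hs.symm)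
  · intro f g hfg _ ih
    have h1 : (fun s => L (f s)) =ᵐ[timeMeasure t] fun s => L (g s) :=
      hfg.mono fun s hs => congrArg L hs
    rwa [← T.conv_congr ht h1]

end FavardConvolution

/-! ### The extrapolation space inside `X` -/

section ExtrapResolvent

variable {X : Type*} [NormedAddCommGroup X] [NormedSpace ℂ X] [CompleteSpace X]

/-- The continuous extension `X₋₁ → X` of the resolvent `R(μ, A)`; an isometry by the choice of the
norm of `X₋₁`. -/
def extrapResolvent (T : C0Semigroup X) (μ : ℂ) : Extrap T μ →L[ℂ] X :=
  (LinearMap.mkContinuous (T.preResolvent μ) 1 (fun x => (one_mul ‖x‖).ge) :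
    PreExtrap T μ →L[ℂ] X).extend
      (UniformSpace.Completion.toComplL : PreExtrap T μ →L[ℂ] UniformSpace.Completion _)

theorem extrapResolvent_toExtrap (T : C0Semigroup X) (μ : ℂ) (x : X) :
    T.extrapResolvent μ (T.toExtrap μ x) = T.resolvent μ x :=
  ContinuousLinearMap.extend_eq
    (LinearMap.mkContinuous (T.preResolvent μ) 1 (fun x => (one_mul ‖x‖).ge) :
      PreExtrap T μ →L[ℂ] X)
    (e := (UniformSpace.Completion.toComplL : PreExtrap T μ →L[ℂ] UniformSpace.Completion _))
    UniformSpace.Completion.denseRange_coe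
    (UniformSpace.Completion.isUniformInducing_coe (PreExtrap T μ)) x

theorem norm_extrapResolvent (T : C0Semigroup X) (μ : ℂ) (y : Extrap T μ) :
    ‖T.extrapResolvent μ y‖ = ‖y‖ := by
  induction y using (T.denseRange_toExtrap μ).induction_on with
  | hp => exact isClosed_eq (by fun_prop) (by fun_prop)
  | ih x => rw [extrapResolvent_toExtrap, norm_toExtrap]

theorem extrapResolvent_injective (T : C0Semigroup X) (μ : ℂ) :
    Function.Injective (T.extrapResolvent μ) :=
  (injective_iff_map_eq_zero _).2 fun y hy => by
    rw [← norm_eq_zero, ← norm_extrapResolvent, hy, norm_zero]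

theorem extrapResolvent_op (T : C0Semigroup X) (μ : ℂ) (t : ℝ≥0) (y : Extrap T μ) :
    T.extrapResolvent μ ((T.extrap μ).op t y) = T.op t (T.extrapResolvent μ y) := by
  change T.extrapResolvent μ (T.extrapOp μ t y) = _
  induction y using (T.denseRange_toExtrap μ).induction_on with
  | hp => exact isClosed_eq (by fun_prop) (by fun_prop)
  | ih x => rw [extrapOp_toExtrap, extrapResolvent_toExtrap, extrapResolvent_toExtrap, resolvent_op]

theorem extrapResolvent_diffQuot (T : C0Semigroup X) (μ : ℂ) (h : ℝ≥0) (y : Extrap T μ) :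
    T.extrapResolvent μ ((T.extrap μ).diffQuot h y) = T.diffQuot h (T.extrapResolvent μ y) := by
  rw [diffQuot, diffQuot, ← Complex.coe_smul, map_smul, Complex.coe_smul, map_sub,
    extrapResolvent_op]

theorem toExtrap_injective (T : C0Semigroup X) {μ : ℂ} (hμ : μ ∈ T.resolventSet) :
    Function.Injective (T.toExtrap μ) := by
  refine (injective_iff_map_eq_zero _).2 fun x hx => ?_
  have h0 : T.resolvent μ x = 0 := by rw [← extrapResolvent_toExtrap, hx, map_zero]
  obtain ⟨h, hx'⟩ := (T.resolvent_spec hμ).1 x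
  have h1 : (⟨T.resolvent μ x, h⟩ : T.generator.domain) = 0 := Subtype.ext h0
  rw [h1, h0] at hx'
  simpa using hx'.symm

/-- An element of `X₋₁` belongs to `X` as soon as the resolvent maps it into `D(A)`. -/
theorem toExtrap_eq_of_mem_domain (T : C0Semigroup X) {μ : ℂ} (hμ : μ ∈ T.resolventSet)
    (y : Extrap T μ) (h : T.extrapResolvent μ y ∈ T.generator.domain) :
    T.toExtrap μ (μ • T.extrapResolvent μ y - T.generator ⟨_, h⟩) = y := by
  refine T.extrapResolvent_injective μ ?_
  rw [extrapResolvent_toExtrap]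
  exact (T.resolvent_spec hμ).2 ⟨_, h⟩

/-- Conversely, an element of `X` is recovered from its image under the resolvent as
`x = lim_{h ↓ 0} (μ w - (1/h) (T(h)w - w))`. -/
theorem tendsto_of_toExtrap_eq (T : C0Semigroup X) {μ : ℂ} (hμ : μ ∈ T.resolventSet)
    {x : X} {y : Extrap T μ} (h : T.toExtrap μ x = y) :
    Tendsto (fun t => μ • T.extrapResolvent μ y - T.diffQuot t (T.extrapResolvent μ y)) (𝓝[>] 0)
      (𝓝 x) := by
  subst h
  obtain ⟨hx, hx'⟩ := (T.resolvent_spec hμ).1 x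
  rw [extrapResolvent_toExtrap]
  conv => enter [3, 1]; rw [← hx']
  exact tendsto_const_nhds.sub (T.generator_spec ⟨_, hx⟩)

/-- The extended resolvent maps into `D(A₋₁)` because its difference quotients are uniformly
bounded; on the dense subspace `X` this is `norm_diffQuot_le` for elements of `D(A)`. -/
theorem HasExpDecay.norm_diffQuot_toExtrap_extrapResolvent_le {T : C0Semigroup X} {M ω : ℝ}
    (hω : 0 < ω) (hT : T.HasExpDecay M ω) {μ : ℂ} (hμ : μ ∈ T.resolventSet) (h : ℝ≥0)
    (y : Extrap T μ) :
    ‖(T.extrap μ).diffQuot h (T.toExtrap μ (T.extrapResolvent μ y))‖ ≤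
      M * ‖μ • T.toExtrap μ (T.extrapResolvent μ y) - y‖ := by
  have hc := ((T.toExtrap μ).comp (T.extrapResolvent μ)).continuous
  induction y using (T.denseRange_toExtrap μ).induction_on with
  | hp =>
    exact isClosed_le (((T.extrap μ).diffQuotL h).continuous.comp hc).norm
      (((hc.const_smul μ).sub continuous_id).norm.const_mul M)
  | ih x =>
    obtain ⟨hx, hx'⟩ := (T.resolvent_spec hμ).1 x
    obtain ⟨hy, hy'⟩ := (T.resolvent_spec hμ).1 (T.resolvent μ x)
    rw [extrapResolvent_toExtrap, ← norm_extrapResolvent,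
      extrapResolvent_diffQuot, extrapResolvent_toExtrap, ← map_smul, ← map_sub,
      norm_toExtrap, map_sub, map_smul]
    have h1 := hT.norm_diffQuot_le hω ⟨_, hy⟩ h
    rwa [show T.generator ⟨_, hy⟩ = μ • T.resolvent μ (T.resolvent μ x) - T.resolvent μ x by
      conv => enter [2, 2]; rw [← hy']
      abel] at h1

theorem tendsto_diffQuot_toExtrap (T : C0Semigroup X) {μ : ℂ} (x : T.generator.domain) :
    Tendsto (fun h => (T.extrap μ).diffQuot h (T.toExtrap μ (x : X))) (𝓝[>] 0)
      (𝓝 (T.toExtrap μ (T.generator x))) := by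
  refine (((T.toExtrap μ).continuous.tendsto _).comp (T.generator_spec x)).congr fun h => ?_
  change T.toExtrap μ (T.diffQuot h x) = (h : ℝ)⁻¹ • (T.extrapOp μ h _ - _)
  rw [diffQuot, ← Complex.coe_smul, map_smul, Complex.coe_smul, map_sub, extrapOp_toExtrap]

/-- `μ ∈ ρ(A₋₁)`, and `R(μ, A₋₁)` is the extension of `R(μ, A)`, followed by the embedding of `X`.
-/
theorem HasExpDecay.isResolventAt_extrap {T : C0Semigroup X} {M ω : ℝ}
    (hω : 0 < ω) (hT : T.HasExpDecay M ω) {μ : ℂ} (hμ : μ ∈ T.resolventSet) :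
    (T.extrap μ).IsResolventAt μ ((T.toExtrap μ).comp (T.extrapResolvent μ)) := by
  refine ⟨fun y => ?_, fun ⟨y, hy⟩ => ?_⟩
  · set Q : Extrap T μ →L[ℂ] Extrap T μ := μ • (T.toExtrap μ).comp (T.extrapResolvent μ) -
      ContinuousLinearMap.id ℂ _ with hQ
    have hM := hT.nonneg
    -- the difference quotients converge on the dense subspace `X` and are uniformly bounded
    have key : Tendsto (fun h => (T.extrap μ).diffQuot h (T.toExtrap μ (T.extrapResolvent μ y)))
        (𝓝[>] 0) (𝓝 (Q y)) := by
      refine Metric.tendsto_nhds.2 fun ε hε => ?_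
      have h0 : 0 < ε / 2 / ((M + 1) * (‖Q‖ + 1)) := by positivity
      obtain ⟨x, hx⟩ := (T.denseRange_toExtrap μ).exists_dist_lt y h0
      obtain ⟨hd, hd'⟩ := (T.resolvent_spec hμ).1 x
      have h1 : T.toExtrap μ (T.generator ⟨_, hd⟩) = Q (T.toExtrap μ x) := by
        have h2 : T.generator ⟨_, hd⟩ = μ • T.resolvent μ x - x := by
          conv => enter [2, 2]; rw [← hd']
          abel
        simp [h2, hQ, extrapResolvent_toExtrap]
      have h3 := T.tendsto_diffQuot_toExtrap (μ := μ) ⟨_, hd⟩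
      rw [h1] at h3
      have hz : ‖Q (y - T.toExtrap μ x)‖ * (M + 1) < ε / 2 := by
        rw [dist_eq_norm, lt_div_iff₀ (by positivity)] at hx
        refine lt_of_le_of_lt ?_ hx
        have h4 := Q.le_opNorm (y - T.toExtrap μ x)
        have h5 : ‖Q‖ * ‖y - T.toExtrap μ x‖ ≤ (‖Q‖ + 1) * ‖y - T.toExtrap μ x‖ :=
          mul_le_mul_of_nonneg_right (by linarith) (norm_nonneg _)
        calc _ ≤ (‖Q‖ + 1) * ‖y - T.toExtrap μ x‖ * (M + 1) :=
              mul_le_mul_of_nonneg_right (h4.trans h5) (by linarith)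
          _ = _ := by ring
      filter_upwards [Metric.tendsto_nhds.1 h3 (ε / 2) (by positivity)] with h hh
      have h6 := hT.norm_diffQuot_toExtrap_extrapResolvent_le hω hμ h (y - T.toExtrap μ x)
      change _ ≤ M * ‖Q (y - T.toExtrap μ x)‖ at h6
      rw [map_sub, map_sub, diffQuot_sub, extrapResolvent_toExtrap] at h6
      rw [dist_eq_norm] at hh ⊢
      have h7 : (T.extrap μ).diffQuot h (T.toExtrap μ (T.extrapResolvent μ y)) - Q y =
          ((T.extrap μ).diffQuot h (T.toExtrap μ (T.extrapResolvent μ y)) -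
            (T.extrap μ).diffQuot h (T.toExtrap μ (T.resolvent μ x))) +
          ((T.extrap μ).diffQuot h (T.toExtrap μ (T.resolvent μ x)) - Q (T.toExtrap μ x)) -
          Q (y - T.toExtrap μ x) := by
        rw [map_sub]
        abel
      rw [h7]
      have h8 := norm_sub_le
        (((T.extrap μ).diffQuot h (T.toExtrap μ (T.extrapResolvent μ y)) -
            (T.extrap μ).diffQuot h (T.toExtrap μ (T.resolvent μ x))) +
          ((T.extrap μ).diffQuot h (T.toExtrap μ (T.resolvent μ x)) - Q (T.toExtrap μ x)))
        (Q (y - T.toExtrap μ x))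
      have h9 := norm_add_le
        ((T.extrap μ).diffQuot h (T.toExtrap μ (T.extrapResolvent μ y)) -
            (T.extrap μ).diffQuot h (T.toExtrap μ (T.resolvent μ x)))
        ((T.extrap μ).diffQuot h (T.toExtrap μ (T.resolvent μ x)) - Q (T.toExtrap μ x))
      linarith
    obtain ⟨hd, hd'⟩ := (T.extrap μ).mem_domain_of_tendsto key
    refine ⟨hd, ?_⟩
    refine (congrArg (fun z => μ • T.toExtrap μ (T.extrapResolvent μ y) - z) hd').trans ?_
    simp [hQ]
  · have h1 := ((T.extrapResolvent μ).continuous.tendsto _).comp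
      ((T.extrap μ).generator_spec ⟨_, hy⟩)
    simp only [Function.comp_def, extrapResolvent_diffQuot] at h1
    obtain ⟨hd, hd'⟩ := T.mem_domain_of_tendsto h1
    have h2 := T.toExtrap_eq_of_mem_domain hμ _ hd
    rw [hd'] at h2
    simpa only [ContinuousLinearMap.comp_apply, map_sub, map_smul] using h2

/-- The range of `R(μ, A₋₁)` is contained in `X`. -/
theorem HasExpDecay.exists_toExtrap_eq_resolvent {T : C0Semigroup X} {M ω : ℝ}
    (hω : 0 < ω) (hT : T.HasExpDecay M ω) {μ : ℂ} (hμ : μ ∈ T.resolventSet)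
    (y : Extrap T μ) : ∃ x : X, T.toExtrap μ x = (T.extrap μ).resolvent μ y := by
  have hR := hT.isResolventAt_extrap hω hμ
  obtain ⟨hd, hd'⟩ := ((T.extrap μ).resolvent_spec ⟨_, hR⟩).1 y
  refine ⟨T.extrapResolvent μ y, ?_⟩
  have h := hR.2 ⟨_, hd⟩
  rwa [hd'] at h

/-- The Favard norm is a norm if the semigroup decays exponentially. -/
abbrev favardNormedAddCommGroup {S : C0Semigroup X} {M ω : ℝ} (hω : 0 < ω)
    (hS : S.HasExpDecay M ω) : NormedAddCommGroup (FavardSpace S) :=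
  NormedAddCommGroup.ofSeparation fun y hy => by
    obtain ⟨K, hK⟩ := S.exists_favardIncl_bound hω hS
    have h1 := hK y
    rw [hy, mul_zero] at h1
    exact Subtype.ext (norm_le_zero_iff.1 h1)

theorem exists_isFavardConstant (T : C0Semigroup X) {M ω : ℝ} (hω : 0 < ω)
    (hT : T.HasExpDecay M ω) {μ : ℂ} (hμ : μ ∈ T.resolventSet) :
    ∃ m : ℝ, 0 < m ∧ T.IsFavardConstant μ ω m := by
  let : NormedAddCommGroup (F0 T μ) := favardNormedAddCommGroup hω (hT.extrap μ)
  have hS := hT.extrap μ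
  let L : F0 T μ →L[ℂ] X := (T.extrapResolvent μ).comp ((T.extrap μ).favardInclL hω hS)
  have hL : ∀ h : ℝ≥0, 0 < h → ∀ y, ‖T.diffQuot h (L y)‖ ≤ ‖y‖ := by
    intro h hh y
    have h1 := favard_le_norm (T.extrap μ) y ⟨h, hh⟩
    rw [← norm_extrapResolvent, extrapResolvent_diffQuot] at h1
    exact h1
  have hM := hT.nonneg
  -- the summands come from `μw` and `Aw` in `x = μw - Aw`; the last one makes the constant positive
  refine ⟨‖μ‖ * (M * ‖L‖) + M + 1, by positivity, fun f hf t ht => ?_⟩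
  have hfi : Integrable f (timeMeasure t) :=
    (hf.integrableOn_compact_subset Set.Icc_subset_Ici_self isCompact_Icc).mono_set
      Set.Ioc_subset_Icc_self
  have hιf : Integrable (fun r => (T.extrap μ).favardInclL hω hS (f r)) (timeMeasure t) :=
    ((T.extrap μ).favardInclL hω hS).integrable_comp hfi
  have hw : T.extrapResolvent μ
      (T.extrapConv μ (fun r => (T.extrap μ).favardIncl (f r)) t) = T.conv (fun r => L (f r)) t :=
    hS.map_conv hω (T.extrapResolvent μ) (T.extrapResolvent_op μ) ht.le hιf
  have hd : T.extrapResolvent μ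
      (T.extrapConv μ (fun r => (T.extrap μ).favardIncl (f r)) t) ∈ T.generator.domain := by
    rw [hw]
    exact hT.conv_mem_domain hω L hL ht.le hfi
  refine ⟨_, T.toExtrap_eq_of_mem_domain hμ _ hd, ?_⟩
  set I := ∫ r in (0 : ℝ)..t, Real.exp (-ω * (t - r)) * ‖f r‖ with hI
  have hI0 : 0 ≤ I := intervalIntegral.integral_nonneg ht.le fun s _ => by positivity
  have h1 : ‖T.generator ⟨_, hd⟩‖ ≤ M * I := by
    refine T.norm_generator_le _ fun h hh => ?_
    simp only [hw]
    exact hT.norm_diffQuot_conv_le hω L hL ht.le hfi hh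
  have h2 : ‖T.conv (fun r => L (f r)) t‖ ≤ M * (‖L‖ * I) := by
    have h3 := hT.norm_conv_le (f := fun r => L (f r)) (g := fun r => ‖L‖ * ‖f r‖) ht.le
      (fun s => by
        rw [Real.norm_of_nonneg (by positivity)]
        exact L.le_opNorm _) (hfi.norm.const_mul _)
    refine h3.trans (le_of_eq ?_)
    congr 1
    rw [hI, ← intervalIntegral.integral_const_mul]
    refine intervalIntegral.integral_congr fun s _ => ?_
    simp only [norm_mul, norm_norm]
    ring
  refine (norm_sub_le _ _).trans ?_
  rw [← hw] at h2
  rw [norm_smul]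
  refine (add_le_add (mul_le_mul_of_nonneg_left h2 (norm_nonneg _)) h1).trans ?_
  linarith

end ExtrapResolvent

/-! ### Integral estimates for the exponential kernel -/

section Kernel

/-- The kernel `x ↦ e^{-ωx}` on `[0, ∞)`, extended by zero. -/
def expKernel (ω x : ℝ) : ℝ≥0∞ :=
  (Set.Ici 0).indicator (fun x => ENNReal.ofReal (Real.exp (-ω * x))) x

theorem measurable_expKernel (ω : ℝ) : Measurable (expKernel ω) :=
  Measurable.indicator (by fun_prop) measurableSet_Ici

theorem lintegral_expKernel {ω : ℝ} (hω : 0 < ω) : ∫⁻ x, expKernel ω x = ENNReal.ofReal ω⁻¹ := by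
  unfold expKernel
  rw [lintegral_indicator measurableSet_Ici, Measure.restrict_congr_set Ioi_ae_eq_Ici.symm,
    ← ofReal_integral_eq_lintegral_ofReal (integrableOn_exp_mul_Ioi (by linarith) 0)
      (Eventually.of_forall fun _ => (Real.exp_pos _).le),
    integral_exp_mul_Ioi (by linarith) 0]
  simp

/-- Young's inequality `‖e^{-ω·} * ‖u‖‖₁ ≤ ω⁻¹ ‖u‖₁` on `(0, t)`. -/
theorem lintegral_exp_mul_integral_le {E : Type*} [NormedAddCommGroup E] {ω : ℝ} (hω : 0 < ω)
    {t : ℝ} {u : ℝ → E} (hu : Integrable u (timeMeasure t)) :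
    ∫⁻ r in Set.Ioc 0 t, ENNReal.ofReal (∫ s in (0 : ℝ)..r, Real.exp (-ω * (r - s)) * ‖u s‖) ≤
      ENNReal.ofReal ω⁻¹ * ∫⁻ s in Set.Ioc 0 t, ‖u s‖ₑ := by
  have h1 : ∀ r ∈ Set.Ioc 0 t,
      ENNReal.ofReal (∫ s in (0 : ℝ)..r, Real.exp (-ω * (r - s)) * ‖u s‖) ≤
        ∫⁻ s in Set.Ioc 0 t, expKernel ω (r - s) * ‖u s‖ₑ := by
    intro r hr
    have hur : Integrable u (timeMeasure r) :=
      IntegrableOn.mono_set (f := u) hu (Set.Ioc_subset_Ioc_right hr.2)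
    rw [intervalIntegral.integral_of_le hr.1.le,
      ofReal_integral_eq_lintegral_ofReal (integrable_exp_mul ω hur)
        (Eventually.of_forall fun _ => by positivity)]
    refine le_trans (le_of_eq ?_) (lintegral_mono_set (Set.Ioc_subset_Ioc_right hr.2))
    refine setLIntegral_congr_fun measurableSet_Ioc fun s hs => ?_
    simp only [expKernel]
    rw [Set.indicator_of_mem (show r - s ∈ Set.Ici (0 : ℝ) from sub_nonneg.2 hs.2),
      ENNReal.ofReal_mul (Real.exp_pos _).le, ofReal_norm]
  have hk : Measurable fun p : ℝ × ℝ => expKernel ω (p.1 - p.2) :=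
    (measurable_expKernel ω).comp (by fun_prop)
  calc _ ≤ ∫⁻ r in Set.Ioc 0 t, ∫⁻ s in Set.Ioc 0 t, expKernel ω (r - s) * ‖u s‖ₑ :=
        setLIntegral_mono' measurableSet_Ioc h1
    _ ≤ ∫⁻ r, ∫⁻ s in Set.Ioc 0 t, expKernel ω (r - s) * ‖u s‖ₑ := setLIntegral_le_lintegral _ _
    _ = ∫⁻ s in Set.Ioc 0 t, ∫⁻ r, expKernel ω (r - s) * ‖u s‖ₑ :=
        lintegral_lintegral_swap (hk.aemeasurable.mul hu.1.enorm.comp_snd)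
    _ = ∫⁻ s in Set.Ioc 0 t, ENNReal.ofReal ω⁻¹ * ‖u s‖ₑ := by
        refine lintegral_congr fun s => ?_
        have h2 : Measurable fun r => expKernel ω (r - s) :=
          (measurable_expKernel ω).comp (by fun_prop)
        rw [lintegral_mul_const _ h2, lintegral_sub_right_eq_self (expKernel ω) s,
          lintegral_expKernel hω]
    _ = _ := lintegral_const_mul'' _ hu.1.enorm

end Kernel

/-! ### The input-output map and the observation map -/

section Maps

variable {X : Type*} [NormedAddCommGroup X] [NormedSpace ℂ X]

theorem HasExpDecay.aestronglyMeasurable_conv {T : C0Semigroup X} {M ω : ℝ} (hω : 0 < ω)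
    (hT : T.HasExpDecay M ω) {f : ℝ → X} {t : ℝ} (hf : AEStronglyMeasurable f (timeMeasure t)) :
    AEStronglyMeasurable (T.conv f) (timeMeasure t) := by
  set g := hf.mk f
  have hg : StronglyMeasurable g := hf.stronglyMeasurable_mk
  have h1 : StronglyMeasurable fun p : ℝ × ℝ =>
      {p : ℝ × ℝ | 0 < p.2 ∧ p.2 ≤ p.1}.indicator
        (fun p => T.op (Real.toNNReal (p.1 - p.2)) (g p.2)) p := by
    refine StronglyMeasurable.indicator ?_ ?_
    · have h2 : StronglyMeasurable fun p : ℝ × ℝ => Real.toNNReal (p.1 - p.2) :=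
        Continuous.stronglyMeasurable (by fun_prop)
      exact (hT.continuous_op hω).comp_stronglyMeasurable
        (h2.prodMk (hg.comp_measurable measurable_snd))
    · exact (measurableSet_lt measurable_const measurable_snd).inter
        (measurableSet_le measurable_snd measurable_fst)
  refine ⟨_, h1.integral_prod_right' (ν := volume),
    (ae_restrict_mem measurableSet_Ioc).mono fun r hr => ?_⟩
  have h3 : f =ᵐ[timeMeasure r] g := ae_restrict_of_ae_restrict_of_subset
    (Set.Ioc_subset_Ioc_right hr.2) hf.ae_eq_mk
  rw [T.conv_congr hr.1.le h3, conv_eq _ _ hr.1.le, timeMeasure, ← integral_indicator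
    measurableSet_Ioc]
  rfl

theorem LpTime.integrable {E : Type*} [NormedAddCommGroup E] {t : ℝ} (u : LpTime E 1 t) :
    Integrable u (timeMeasure t) :=
  L1.integrable_coeFn u

theorem LpTime.enorm_eq {E : Type*} [NormedAddCommGroup E] {t : ℝ} (u : LpTime E 1 t) :
    ‖u‖ₑ = ∫⁻ s in Set.Ioc 0 t, ‖u s‖ₑ := by
  rw [Lp.enorm_def, eLpNorm_one_eq_lintegral_enorm]

/-- Convolution estimate for a bounded operator `B` with values in the Favard class. -/
theorem IsFavardConstant.exists_state [CompleteSpace X] {T : C0Semigroup X} {M ω : ℝ} (hω : 0 < ω)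
    (hT : T.HasExpDecay M ω) {μ : ℂ} {m : ℝ} (hm0 : 0 < m) (hm : T.IsFavardConstant μ ω m)
    (B : X →L[ℂ] F0 T μ) {t : ℝ} {u : ℝ → X} (hu : Integrable u (timeMeasure t))
    {r : ℝ} (hr : r ∈ Set.Ioc 0 t) :
    ∃ x : X, T.toExtrap μ x =
        T.extrapConv μ (fun s => ((T.extrap μ).favardInclL hω (hT.extrap μ)).comp B (u s)) r ∧
      ‖x‖ ≤ m * ‖B‖ * ∫ s in (0 : ℝ)..r, Real.exp (-ω * (r - s)) * ‖u s‖ := by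
  let : NormedAddCommGroup (F0 T μ) := favardNormedAddCommGroup hω (hT.extrap μ)
  have hf : Integrable ((Set.Ioc 0 t).indicator fun s => B (u s)) :=
    (integrable_indicator_iff measurableSet_Ioc).2 (B.integrable_comp hu)
  obtain ⟨x, hx, hxn⟩ := hm _ (hf.locallyIntegrable.locallyIntegrableOn _) r hr.1
  have hmem : ∀ s ∈ Set.Ioc 0 r, s ∈ Set.Ioc 0 t := fun s hs => ⟨hs.1, hs.2.trans hr.2⟩
  refine ⟨x, hx.trans ?_, hxn.trans ?_⟩
  · refine (T.extrap μ).conv_congr hr.1.le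
      ((ae_restrict_mem measurableSet_Ioc).mono fun s hs => ?_)
    simp only [Set.indicator_of_mem (hmem s hs)]
    rfl
  · rw [mul_assoc, ← intervalIntegral.integral_const_mul ‖B‖,
      intervalIntegral.integral_of_le hr.1.le, intervalIntegral.integral_of_le hr.1.le]
    have hur : Integrable u (timeMeasure r) :=
      IntegrableOn.mono_set (f := u) hu (Set.Ioc_subset_Ioc_right hr.2)
    refine mul_le_mul_of_nonneg_left ?_ hm0.le
    refine integral_mono_of_nonneg
      (Eventually.of_forall fun s => mul_nonneg (Real.exp_pos _).le (norm_nonneg _))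
      ((integrable_exp_mul ω hur).const_mul _)
      ((ae_restrict_mem measurableSet_Ioc).mono fun s hs => ?_)
    simp only [Set.indicator_of_mem (hmem s hs)]
    rw [mul_left_comm]
    exact mul_le_mul_of_nonneg_left (B.le_opNorm _) (Real.exp_pos _).le

theorem lintegral_enorm_le_of_norm_le {E : Type*} [NormedAddCommGroup E] {ω : ℝ} (hω : 0 < ω)
    {c t : ℝ} (hc : 0 ≤ c) {u z : ℝ → E}
    (hu : Integrable u (timeMeasure t))
    (hz : ∀ r ∈ Set.Ioc 0 t, ‖z r‖ ≤ c * ∫ s in (0 : ℝ)..r, Real.exp (-ω * (r - s)) * ‖u s‖) :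
    ∫⁻ r in Set.Ioc 0 t, ‖z r‖ₑ ≤ ENNReal.ofReal (c / ω) * ∫⁻ s in Set.Ioc 0 t, ‖u s‖ₑ := by
  calc ∫⁻ r in Set.Ioc 0 t, ‖z r‖ₑ
      ≤ ∫⁻ r in Set.Ioc 0 t, ENNReal.ofReal c *
          ENNReal.ofReal (∫ s in (0 : ℝ)..r, Real.exp (-ω * (r - s)) * ‖u s‖) := by
        refine setLIntegral_mono' measurableSet_Ioc fun r hr => ?_
        rw [← ofReal_norm, ← ENNReal.ofReal_mul hc]
        exact ENNReal.ofReal_le_ofReal (hz r hr)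
    _ = ENNReal.ofReal c * ∫⁻ r in Set.Ioc 0 t,
          ENNReal.ofReal (∫ s in (0 : ℝ)..r, Real.exp (-ω * (r - s)) * ‖u s‖) :=
        lintegral_const_mul' _ _ ENNReal.ofReal_ne_top
    _ ≤ ENNReal.ofReal c * (ENNReal.ofReal ω⁻¹ * ∫⁻ s in Set.Ioc 0 t, ‖u s‖ₑ) := by
        gcongr
        exact lintegral_exp_mul_integral_le hω hu
    _ = _ := by rw [← mul_assoc, ← ENNReal.ofReal_mul hc, div_eq_mul_inv]

theorem norm_le_of_lintegral_le {E : Type*} [NormedAddCommGroup E] {t c : ℝ} (hc : 0 ≤ c)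
    {v : LpTime E 1 t} {a : ℝ} (ha : 0 ≤ a)
    (h : ∫⁻ r in Set.Ioc 0 t, ‖v r‖ₑ ≤ ENNReal.ofReal c * ENNReal.ofReal a) : ‖v‖ ≤ c * a := by
  rw [← LpTime.enorm_eq, ← ENNReal.ofReal_mul hc, ← ofReal_norm] at h
  exact (ENNReal.ofReal_le_ofReal_iff (by positivity)).1 h

/-- The convolution of an input `u ∈ L¹(0, t; X)` is an `X`-valued `L¹`-function. It is measurable
as a limit of difference quotients of an `X`-valued convolution. -/
theorem IsFavardConstant.exists_output [CompleteSpace X] {T : C0Semigroup X} {M ω : ℝ} (hω : 0 < ω)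
    (hT : T.HasExpDecay M ω) {μ : ℂ} (hμ : μ ∈ T.resolventSet) {m : ℝ} (hm0 : 0 < m)
    (hm : T.IsFavardConstant μ ω m) (B : X →L[ℂ] F0 T μ) {t : ℝ} (u : LpTime X 1 t) :
    ∃ v : LpTime X 1 t, (∀ᵐ r ∂timeMeasure t, T.toExtrap μ (v r) =
        T.extrapConv μ (fun s => ((T.extrap μ).favardInclL hω (hT.extrap μ)).comp B (u s)) r) ∧
      ‖v‖ ≤ m * ‖B‖ / ω * ‖u‖ := by
  have hu := LpTime.integrable u
  set B' := ((T.extrap μ).favardInclL hω (hT.extrap μ)).comp B with hB'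
  choose! z hz hzn using fun r (hr : r ∈ Set.Ioc 0 t) =>
    hm.exists_state hω hT hm0 B hu hr
  set w : ℝ → X := T.conv fun s => T.extrapResolvent μ (B' (u s)) with hw
  have hwm : AEStronglyMeasurable w (timeMeasure t) :=
    hT.aestronglyMeasurable_conv hω
      (((T.extrapResolvent μ).comp B').continuous.comp_aestronglyMeasurable hu.1)
  have hwz : ∀ r ∈ Set.Ioc 0 t, T.extrapResolvent μ (T.extrapConv μ (fun s => B' (u s)) r) = w r :=
    fun r hr => (hT.extrap μ).map_conv hω (T.extrapResolvent μ) (T.extrapResolvent_op μ) hr.1.le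
      (B'.integrable_comp (IntegrableOn.mono_set (f := u) hu (Set.Ioc_subset_Ioc_right hr.2)))
  have hz_lim : ∀ r ∈ Set.Ioc 0 t,
      Tendsto (fun n : ℕ => μ • w r - T.diffQuotL (1 / ((n : ℝ≥0) + 1)) (w r)) atTop (𝓝 (z r)) := by
    intro r hr
    have h1 := T.tendsto_of_toExtrap_eq hμ (hz r hr)
    rw [hwz r hr] at h1
    refine h1.comp (tendsto_nhdsWithin_iff.2 ⟨tendsto_one_div_add_atTop_nhds_zero_nat,
      Eventually.of_forall fun n => ?_⟩)
    exact Set.mem_Ioi.2 (by positivity)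
  have hzm : AEStronglyMeasurable z (timeMeasure t) :=
    aestronglyMeasurable_of_tendsto_ae atTop
      (fun n : ℕ => (hwm.const_smul μ).sub
        ((T.diffQuotL (1 / ((n : ℝ≥0) + 1))).continuous.comp_aestronglyMeasurable hwm))
      ((ae_restrict_mem measurableSet_Ioc).mono hz_lim)
  have hzi := lintegral_enorm_le_of_norm_le hω (mul_nonneg hm0.le (norm_nonneg B)) hu hzn
  rw [← LpTime.enorm_eq, ← ofReal_norm] at hzi
  have hzL : MemLp z 1 (timeMeasure t) := by
    refine ⟨hzm, ?_⟩
    rw [eLpNorm_one_eq_lintegral_enorm]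
    exact hzi.trans_lt (ENNReal.mul_lt_top ENNReal.ofReal_lt_top ENNReal.ofReal_lt_top)
  refine ⟨hzL.toLp z, ?_, ?_⟩
  · filter_upwards [hzL.coeFn_toLp, ae_restrict_mem measurableSet_Ioc] with r h1 hr
    rw [h1, hz r hr]
  · refine norm_le_of_lintegral_le (by positivity) (norm_nonneg u) (le_trans (le_of_eq ?_) hzi)
    exact lintegral_congr_ae (hzL.coeFn_toLp.mono fun r hr => by simp only [hr])

/-- The input-output map `u ↦ ∫₀^· T₋₁(· - s) B u(s) ds` on `L¹(0, t; X)`, with its norm bound. -/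
theorem IsFavardConstant.exists_inputOutput [CompleteSpace X] {T : C0Semigroup X} {M ω : ℝ}
    (hω : 0 < ω) (hT : T.HasExpDecay M ω) {μ : ℂ} (hμ : μ ∈ T.resolventSet) {m : ℝ} (hm0 : 0 < m)
    (hm : T.IsFavardConstant μ ω m) (B : X →L[ℂ] F0 T μ) (t : ℝ) :
    ∃ F : LpTime X 1 t →L[ℂ] LpTime X 1 t, (∀ u, ∀ᵐ r ∂timeMeasure t, T.toExtrap μ (F u r) =
        T.extrapConv μ (fun s => ((T.extrap μ).favardInclL hω (hT.extrap μ)).comp B (u s)) r) ∧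
      ‖F‖ ≤ m * ‖B‖ / ω := by
  choose F hF hFn using fun u : LpTime X 1 t => hm.exists_output hω hT hμ hm0 B u
  set B' := ((T.extrap μ).favardInclL hω (hT.extrap μ)).comp B with hB'
  have hsub : ∀ {r} {f g : ℝ → X}, r ∈ Set.Ioc 0 t → f =ᵐ[timeMeasure t] g →
      (fun s => B' (f s)) =ᵐ[timeMeasure r] fun s => B' (g s) := fun hr h =>
    (ae_restrict_of_ae_restrict_of_subset (Set.Ioc_subset_Ioc_right hr.2) h).mono
      fun s hs => congrArg B' hs
  have hint : ∀ {r} (u : LpTime X 1 t), r ∈ Set.Ioc 0 t →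
      Integrable (fun s => B' (u s)) (timeMeasure r) := fun u hr =>
    B'.integrable_comp (IntegrableOn.mono_set (f := u) (LpTime.integrable u)
      (Set.Ioc_subset_Ioc_right hr.2))
  refine ⟨LinearMap.mkContinuous ⟨⟨F, fun u v => ?_⟩, fun c u => ?_⟩ (m * ‖B‖ / ω) hFn, hF,
    LinearMap.mkContinuous_norm_le _ (by positivity) _⟩
  · refine Lp.ext ?_
    filter_upwards [hF (u + v), hF u, hF v, Lp.coeFn_add (F u) (F v),
      ae_restrict_mem measurableSet_Ioc] with r h1 h2 h3 h4 hr
    refine T.toExtrap_injective hμ ?_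
    rw [h1, h4, Pi.add_apply, map_add, h2, h3]
    refine ((T.extrap μ).conv_congr hr.1.le (hsub hr (Lp.coeFn_add u v))).trans ?_
    simp only [Pi.add_apply, map_add]
    exact (hT.extrap μ).conv_add hω hr.1.le (hint u hr) (hint v hr)
  · refine Lp.ext ?_
    filter_upwards [hF (c • u), hF u, Lp.coeFn_smul c (F u),
      ae_restrict_mem measurableSet_Ioc] with r h1 h2 h4 hr
    refine T.toExtrap_injective hμ ?_
    rw [RingHom.id_apply, h4, Pi.smul_apply, map_smul, h2]
    refine h1.trans (((T.extrap μ).conv_congr hr.1.le (hsub hr (Lp.coeFn_smul c u))).trans ?_)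
    simp only [Pi.smul_apply, map_smul]
    exact (T.extrap μ).conv_smul c _ r

theorem HasExpDecay.lintegral_orbit_le {T : C0Semigroup X} {M ω : ℝ} (hω : 0 < ω)
    (hT : T.HasExpDecay M ω) (t : ℝ) (x : X) :
    ∫⁻ s in Set.Ioc 0 t, ‖T.op (Real.toNNReal s) x‖ₑ ≤
      ENNReal.ofReal (M / ω) * ENNReal.ofReal ‖x‖ := by
  have hM := hT.nonneg
  calc ∫⁻ s in Set.Ioc 0 t, ‖T.op (Real.toNNReal s) x‖ₑ
      ≤ ∫⁻ s in Set.Ioc 0 t, ENNReal.ofReal (M * ‖x‖) * expKernel ω s := by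
        refine setLIntegral_mono' measurableSet_Ioc fun s hs => ?_
        simp only [expKernel]
        rw [Set.indicator_of_mem (show s ∈ Set.Ici (0 : ℝ) from hs.1.le), ← ofReal_norm,
          ← ENNReal.ofReal_mul (by positivity)]
        refine ENNReal.ofReal_le_ofReal ((hT.norm_op_apply_le _ x).trans (le_of_eq ?_))
        rw [Real.coe_toNNReal _ hs.1.le]
        ring
    _ ≤ ∫⁻ s, ENNReal.ofReal (M * ‖x‖) * expKernel ω s := setLIntegral_le_lintegral _ _
    _ = _ := by
        rw [lintegral_const_mul' _ _ ENNReal.ofReal_ne_top, lintegral_expKernel hω,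
          ← ENNReal.ofReal_mul (by positivity), ← ENNReal.ofReal_mul (by positivity)]
        congr 1
        ring

/-- The observation map `x ↦ T(·)x` from `X` to `L¹(0, t; X)`, with its norm bound. -/
theorem HasExpDecay.exists_observation {T : C0Semigroup X} {M ω : ℝ} (hω : 0 < ω)
    (hT : T.HasExpDecay M ω) (t : ℝ) :
    ∃ C : X →L[ℂ] LpTime X 1 t, (∀ x, C x =ᵐ[timeMeasure t] fun s => T.op (Real.toNNReal s) x) ∧
      ‖C‖ ≤ M / ω := by
  have hM := hT.nonneg
  have hL : ∀ x, MemLp (fun s => T.op (Real.toNNReal s) x) 1 (timeMeasure t) := fun x => by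
    refine ⟨((T.strongly_continuous x).comp continuous_real_toNNReal).aestronglyMeasurable, ?_⟩
    rw [eLpNorm_one_eq_lintegral_enorm]
    exact (hT.lintegral_orbit_le hω t x).trans_lt
      (ENNReal.mul_lt_top ENNReal.ofReal_lt_top ENNReal.ofReal_lt_top)
  refine ⟨LinearMap.mkContinuous ⟨⟨fun x => (hL x).toLp _, fun x y => ?_⟩, fun c x => ?_⟩ (M / ω)
    fun x => ?_, fun x => (hL x).coeFn_toLp, LinearMap.mkContinuous_norm_le _ (by positivity) _⟩
  · rw [← MemLp.toLp_add]
    exact MemLp.toLp_congr _ _ (Eventually.of_forall fun s => map_add _ _ _)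
  · rw [RingHom.id_apply, ← MemLp.toLp_const_smul c (hL x)]
    exact MemLp.toLp_congr (hL (c • x)) ((hL x).const_smul c)
      (Eventually.of_forall fun s => map_smul _ _ _)
  · refine norm_le_of_lintegral_le (by positivity) (norm_nonneg x)
      (le_trans (le_of_eq ?_) (hT.lintegral_orbit_le hω t x))
    exact lintegral_congr_ae ((hL x).coeFn_toLp.mono fun r hr => congrArg enorm hr)

end Maps

/-! ### The perturbation theorem -/

section Perturbation

variable {X : Type*} [NormedAddCommGroup X] [NormedSpace ℂ X]

theorem MemW20.integrable {f : ℝ → X} {t : ℝ} (ht : 0 ≤ t) (hf : MemW20 1 t f) :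
    Integrable f (timeMeasure t) := by
  obtain ⟨g, h, hh, hg, hf⟩ := hf
  have key : ∀ {a b : ℝ → X}, IntegrableOn a (Set.Ioc 0 t) →
      (∀ r ∈ Set.Icc 0 t, b r = ∫ s in (0 : ℝ)..r, a s) → IntegrableOn b (Set.Ioc 0 t) := by
    intro a b ha hb
    have h1 := intervalIntegral.continuousOn_primitive_interval (a := 0) (b := t) (f := a)
      (μ := volume)
      (by rwa [Set.uIcc_of_le ht, integrableOn_Icc_iff_integrableOn_Ioc])
    rw [Set.uIcc_of_le ht] at h1
    exact ((h1.congr hb).integrableOn_compact isCompact_Icc).mono_set Set.Ioc_subset_Icc_self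
  exact key (key (memLp_one_iff_integrable.1 hh) hg) hf

/-- Neumann series bound for the inverse of `1 - F`. -/
theorem norm_inverse_one_sub_le {E : Type*} [NormedAddCommGroup E] [NormedSpace ℂ E]
    [CompleteSpace E] (F : E →L[ℂ] E) {q : ℝ} (hF : ‖F‖ ≤ q) (hq : q < 1) :
    IsUnit (1 - F) ∧ ‖Ring.inverse (1 - F)‖ ≤ (1 - q)⁻¹ := by
  have hu : IsUnit (1 - F) := isUnit_one_sub_of_norm_lt_one (hF.trans_lt hq)
  refine ⟨hu, ?_⟩
  set S := Ring.inverse (1 - F) with hS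
  have h1 : S = 1 + S * F := by
    have h2 : S * (1 - F) = 1 := Ring.inverse_mul_cancel _ hu
    rw [mul_sub, mul_one] at h2
    exact sub_eq_iff_eq_add.1 h2
  have h3 : ‖S‖ ≤ 1 + ‖S‖ * q := calc
    ‖S‖ = ‖1 + S * F‖ := congrArg norm h1
    _ ≤ ‖(1 : E →L[ℂ] E)‖ + ‖S * F‖ := norm_add_le _ _
    _ ≤ 1 + ‖S‖ * q := add_le_add ContinuousLinearMap.norm_id_le
        ((norm_mul_le _ _).trans (mul_le_mul_of_nonneg_left hF (norm_nonneg _)))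
  rw [← one_div, le_div_iff₀ (by linarith)]
  linarith

theorem isIntermediate_id (T : C0Semigroup X) : T.IsIntermediate (ContinuousLinearMap.id ℂ X) :=
  ⟨Function.injective_id, fun x _ => ⟨x, rfl⟩, 1, fun z h => by
    rw [one_mul]
    exact le_add_of_nonneg_right (norm_nonneg _)⟩

theorem HasExpDecay.isObservationAdmissible_id {T : C0Semigroup X} {M ω : ℝ} (hω : 0 < ω)
    (hT : T.HasExpDecay M ω) : T.IsObservationAdmissible (ContinuousLinearMap.id ℂ X)
      (ContinuousLinearMap.id ℂ X) 1 := by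
  have hM := hT.nonneg
  refine ⟨M / ω, by positivity, 1, one_pos, fun x _ =>
    ⟨fun s => T.op s.toNNReal x, fun s _ => rfl, ?_⟩⟩
  simp only [ENNReal.toReal_one, ENNReal.rpow_one, Real.rpow_one, ContinuousLinearMap.id_apply]
  rw [ENNReal.ofReal_mul (by positivity)]
  exact hT.lintegral_orbit_le hω 1 x

variable [CompleteSpace X]

theorem IsFavardConstant.isInfiniteTimeControlAdmissible {T : C0Semigroup X} {M ω : ℝ}
    (hω : 0 < ω) (hT : T.HasExpDecay M ω) {μ : ℂ} {m : ℝ} (hm0 : 0 < m)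
    (hm : T.IsFavardConstant μ ω m) (B : X →L[ℂ] F0 T μ) :
    T.IsInfiniteTimeControlAdmissible μ
      (((T.extrap μ).favardInclL hω (hT.extrap μ)).comp B) 1 := by
  refine ⟨m * ‖B‖, by positivity, fun t ht u => ?_⟩
  have hu := LpTime.integrable u
  obtain ⟨x, hx, hxn⟩ := hm.exists_state hω hT hm0 B hu ⟨ht, le_rfl⟩
  refine ⟨x, hx, hxn.trans (mul_le_mul_of_nonneg_left ?_ (by positivity))⟩
  rw [L1.norm_eq_integral_norm]
  exact exp_mul_integral_le hω ht.le hu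

theorem IsFavardConstant.isPairAdmissible {T : C0Semigroup X} {M ω : ℝ}
    (hω : 0 < ω) (hT : T.HasExpDecay M ω) {μ : ℂ} {m : ℝ} (hm0 : 0 < m)
    (hm : T.IsFavardConstant μ ω m) (B : X →L[ℂ] F0 T μ) :
    T.IsPairAdmissible μ (ContinuousLinearMap.id ℂ X)
      (((T.extrap μ).favardInclL hω (hT.extrap μ)).comp B) (ContinuousLinearMap.id ℂ X) 1 := by
  refine ⟨m * ‖B‖ / ω, by positivity, 1, one_pos, fun u hu => ?_⟩
  have hui := hu.integrable zero_le_one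
  choose! z hz hzn using fun r (hr : r ∈ Set.Ioc (0 : ℝ) 1) =>
    hm.exists_state hω hT hm0 B hui hr
  refine ⟨z, hz, ?_⟩
  simp only [ENNReal.toReal_one, ENNReal.rpow_one, ContinuousLinearMap.id_apply]
  exact lintegral_enorm_le_of_norm_le hω (by positivity) hui hzn

/-- An operator given by the convolution for every `u ∈ L¹(0, t; X)`, and not only on the dense
subspace of the definition, is the input-output map. -/
theorem isInputOutputMap_of_ae_eq {T : C0Semigroup X} {μ : ℂ} {B : X →L[ℂ] Extrap T μ} {t : ℝ}
    {F : LpTime X 1 t →L[ℂ] LpTime X 1 t}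
    (hF : ∀ u, ∀ᵐ r ∂timeMeasure t,
      T.toExtrap μ (F u r) = T.extrapConv μ (fun s => B (u s)) r) :
    T.IsInputOutputMap μ (ContinuousLinearMap.id ℂ X) B (ContinuousLinearMap.id ℂ X) F := by
  intro f _ u huf
  filter_upwards [hF u, ae_restrict_mem measurableSet_Ioc] with r h1 hr
  refine ⟨F u r, h1.trans ((T.extrap μ).conv_congr hr.1.le ?_), rfl⟩
  exact (ae_restrict_of_ae_restrict_of_subset (Set.Ioc_subset_Ioc_right hr.2) huf).mono
    fun s hs => congrArg B hs

end Perturbation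

end C0Semigroup

end

theorem mainTheorem7 {X : Type*} [NormedAddCommGroup X] [NormedSpace ℂ X] [CompleteSpace X]
    (T : C0Semigroup X) (M ω : ℝ) (hω : 0 < ω) (hT : T.HasExpDecay M ω)
    (μ : ℂ) (hμ : μ ∈ T.resolventSet) :
    (∃ m : ℝ, 0 < m ∧ T.IsFavardConstant μ ω m) ∧
      ∀ m : ℝ, 0 < m → T.IsFavardConstant μ ω m →
        ∀ B : X →L[ℂ] C0Semigroup.F0 T μ, m * ‖B‖ < ω →
          T.IsInfiniteTimeStaffansWeiss μ (ContinuousLinearMap.id ℂ X)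
            (((T.extrap μ).favardInclL hω (hT.extrap μ)).comp B)
            (ContinuousLinearMap.id ℂ X) := by
  refine ⟨T.exists_isFavardConstant hω hT hμ, fun m hm0 hm B hB => ?_⟩
  have hq : m * ‖B‖ / ω < 1 := (div_lt_one hω).2 hB
  have hctrl := hm.isInfiniteTimeControlAdmissible hω hT hm0 B
  refine ⟨1, ⟨le_rfl⟩, ENNReal.one_ne_top, ⟨T.isIntermediate_id, ?_, ?_,
    hT.isObservationAdmissible_id hω, hm.isPairAdmissible hω hT hm0 B, ?_⟩, hctrl,
    (1 - m * ‖B‖ / ω)⁻¹ * (M / ω), fun t ht => ?_⟩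
  · exact ⟨μ, hμ, fun u => hT.exists_toExtrap_eq_resolvent hω hμ _⟩
  · obtain ⟨M_B, -, h⟩ := hctrl
    exact ⟨1, one_pos, fun u => (h 1 one_pos u).imp fun _ hx => hx.1⟩
  · obtain ⟨F, hF, hFn⟩ := hm.exists_inputOutput hω hT hμ hm0 B 1
    exact ⟨1, one_pos, F, C0Semigroup.isInputOutputMap_of_ae_eq hF,
      (C0Semigroup.norm_inverse_one_sub_le F hFn hq).1⟩
  · obtain ⟨F, hF, hFn⟩ := hm.exists_inputOutput hω hT hμ hm0 B t
    obtain ⟨C, hC, hCn⟩ := hT.exists_observation hω t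
    obtain ⟨hu, hinv⟩ := C0Semigroup.norm_inverse_one_sub_le F hFn hq
    refine ⟨F, C, C0Semigroup.isInputOutputMap_of_ae_eq hF, fun x _ =>
      (hC x).mono fun s hs => ⟨_, rfl, hs⟩, hu, ?_⟩
    exact (ContinuousLinearMap.opNorm_comp_le _ _).trans
      (mul_le_mul hinv hCn (norm_nonneg _) ((norm_nonneg _).trans hinv))
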